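/- **Theorem 3.1.** Let $p_0$ be a probability measure on $\mathbb R^n$, let $0\le\varepsilon<T$, and for $t\ge 0$ let $p_t=p_0*\mathcal N(0,t^2I)$. Consider the probability-flow ODE $$\frac{dx_t}{dt}=-t\,\nabla\log p_t(x_t),\qquad t\in(\varepsilon,T],$$ whose trajectories are taken continuous on $[\varepsilon,T]$. Let $g$ be a consistency function, that is, $g(x_s,s)=g(x_t,t)$ for all $s,t\in[\varepsilon,T]$ along every trajectory, and $g(x,\varepsilon)=x$ for every $x$ (so $g(x_t,t)=x_\varepsilon$). Let the consistency model be $$f(x,t,\theta)=\frac{0.5^2}{r_t^2+0.5^2}\,x+\frac{0.5\,r_t}{\sqrt{0.5^2+r_t^2}}\,F_\theta\Big(\frac{x}{\sqrt{r_t^2+0.5^2}},t\Big),\qquad r_t=t-\varepsilon,$$ with an arbitrary family of networks $F_\theta$. Let $d$ be a measurable distance function with $d(x,y)\ge\|x-y\|_2$ (for instance $d(x,y)=\|x-y\|_2$), and let $L>0$. For a partition $\varepsilon=t_0<t_1<\dots<t_N=T$ put $\Delta t=\max_i(t_i-t_{i-1})$ and, for $0\le k\le N$, $$\mathcal L_{CT}^{t_k}=\sum_{i=1}^k\mathbb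 E\big[d\big(f(x_0+t_iz,t_i,\theta),\,f(x_0+t_{i-1}z,t_{i-1},\theta)\big)\big],$$ with $x_0\sim p_0$ and $z\sim\mathcal N(0,I)$ independent. Let $\mathcal W[p,q]=\inf_\gamma\int\|x-y\|_2\,d\gamma(x,y)$, the infimum being over all joint distributions $\gamma$ of $p$ and $q$. Expectations and distances may be infinite. Then there are a constant $C\ge0$ and a function $R$ with $R(\delta)=o(\delta)$ as $\delta\downarrow0$, which do not depend on $\theta$, on the sampling distributions $q_t$, on the partition or on $k$, such that the following holds. Let $\theta$ be such that $\|f(x,t,\theta)-f(y,t,\theta)\|_2\le L\|x-y\|_2$ for all $x,y$ and all $t\in[\varepsilon,T]$. Let $(q_t)$ be any family of probability measures (the sampling noise distributions), and take any partition as above and any $0\le k\le N$. Let $f_{t_k}$ be the law of $f(x,t_k,\theta)$ for $x\sim q_{t_k}$, and $g_{t_k}$ the law of $g(y,t_k)$ for $y\sim p_{t_k}$. Then $$\mathcal W[f_{t_k},g_{t_k}]=\mathcal W[f_{t_k},p_\varepsilon]\le L\,\mathcal W[q_{t_k},p_{t_k}]+\mathcal L_{CT}^{t_k}+t_k\cdot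 C\,\Delta t+R(\Delta t),$$ where $t_k\cdot C\,\Delta t+R(\Delta t)$ is replaced by $0$ if it is negative. For the data distribution itself, $\mathcal W[f_{t_k},p_0]$ is at most the same right-hand side plus $\varepsilon\sqrt n$. In particular, for $\varepsilon=0$, $$\mathcal W[f_{t_k},g_{t_k}]=\mathcal W[f_{t_k},p_0]\le L\,\mathcal W[q_{t_k},p_{t_k}]+\mathcal L_{CT}^{t_k}+t_k\,O(\Delta t)+o(\Delta t).$$ -/

import Mathlib

open MeasureTheory ProbabilityTheory Filter Topology
open scoped ENNReal Gradient

namespace ConsistencyModel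

/-- `γ` is a joint distribution with marginals `μ` and `ν`. -/
def IsCoupling {E : Type*} [MeasurableSpace E] (γ : Measure (E × E)) (μ ν : Measure E) : Prop :=
  γ.map Prod.fst = μ ∧ γ.map Prod.snd = ν

/-- The Wasserstein distance `inf_γ ∫ ‖x - y‖ dγ(x, y)` over all joint distributions `γ` of
`μ` and `ν`, with the Euclidean norm as cost; it may be infinite. -/
noncomputable def wasserstein {n : ℕ} (μ ν : Measure (EuclideanSpace ℝ (Fin n))) : ℝ≥0∞ :=
  ⨅ (γ : Measure (EuclideanSpace ℝ (Fin n) × EuclideanSpace ℝ (Fin n))) (_ : IsCoupling γ μ ν),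
    ∫⁻ w, ENNReal.ofReal ‖w.1 - w.2‖ ∂γ

/-- The smoothed data distribution `p_t = p₀ ∗ N(0, t² I)`. -/
noncomputable def smoothed {n : ℕ} (p0 : Measure (EuclideanSpace ℝ (Fin n))) (t : ℝ) :
    Measure (EuclideanSpace ℝ (Fin n)) :=
  Measure.conv p0 ((stdGaussian (EuclideanSpace ℝ (Fin n))).map (fun z => t • z))

/-- The Lebesgue density of `p_t = p₀ ∗ N(0, t² I)` for `t > 0`. -/
noncomputable def smoothedDensity {n : ℕ} (p0 : Measure (EuclideanSpace ℝ (Fin n))) (t : ℝ)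
    (x : EuclideanSpace ℝ (Fin n)) : ℝ :=
  ∫ a, (2 * Real.pi * t ^ 2) ^ (-(n : ℝ) / 2) * Real.exp (-‖x - a‖ ^ 2 / (2 * t ^ 2)) ∂p0

/-- The score `∇ₓ log p_t(x)`. -/
noncomputable def score {n : ℕ} (p0 : Measure (EuclideanSpace ℝ (Fin n))) (t : ℝ)
    (x : EuclideanSpace ℝ (Fin n)) : EuclideanSpace ℝ (Fin n) :=
  ∇ (fun y => Real.log (smoothedDensity p0 t y)) x

/-- `x` is a trajectory on `[ε, T]` of the probability-flow equation
`dx = - t ∇ log p_t(x) dt`. It is continuous up to the initial time `ε`, where the equation itself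
is not required, since `p_t` need not have a density when `t = ε = 0`; for `ε > 0` it then holds
at `ε` as well, by continuity. -/
def IsTrajectory {n : ℕ} (p0 : Measure (EuclideanSpace ℝ (Fin n))) (ε T : ℝ)
    (x : ℝ → EuclideanSpace ℝ (Fin n)) : Prop :=
  ContinuousOn x (Set.Icc ε T) ∧
    ∀ t ∈ Set.Ioc ε T, HasDerivWithinAt x (-(t • score p0 t (x t))) (Set.Icc ε T) t

/-- `g` is a consistency function: it is constant along every trajectory, and it is the identity
at the initial time. Hence `g (x t) t = x ε` on every trajectory `x`. -/
structure IsConsistencyFunction {n : ℕ} (p0 : Measure (EuclideanSpace ℝ (Fin n))) (ε T : ℝ)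
    (g : EuclideanSpace ℝ (Fin n) → ℝ → EuclideanSpace ℝ (Fin n)) : Prop where
  const_on_trajectory : ∀ x, IsTrajectory p0 ε T x →
    ∀ s ∈ Set.Icc ε T, ∀ t ∈ Set.Icc ε T, g (x s) s = g (x t) t
  initial : ∀ x, g x ε = x

/-- The consistency model built from the network output `F θ`, with `r_t = t - ε`. -/
noncomputable def model {n : ℕ} {Θ : Type*}
    (F : Θ → EuclideanSpace ℝ (Fin n) → ℝ → EuclideanSpace ℝ (Fin n)) (ε : ℝ)
    (x : EuclideanSpace ℝ (Fin n)) (t : ℝ) (θ : Θ) : EuclideanSpace ℝ (Fin n) :=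
  ((0.5 : ℝ) ^ 2 / ((t - ε) ^ 2 + (0.5 : ℝ) ^ 2)) • x +
    ((0.5 : ℝ) * (t - ε) / √((0.5 : ℝ) ^ 2 + (t - ε) ^ 2)) •
      F θ ((1 / √((t - ε) ^ 2 + (0.5 : ℝ) ^ 2)) • x) t

/-- A partition `ε = t₀ < t₁ < ⋯ < t_N = T`; only the values `time i` with `i ≤ N` matter. -/
structure TimeGrid (ε T : ℝ) where
  N : ℕ
  time : ℕ → ℝ
  time_zero : time 0 = ε
  time_last : time N = T
  time_lt : ∀ i < N, time i < time (i + 1)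

/-- `Δt`, the largest step of the partition. -/
noncomputable def TimeGrid.mesh {ε T : ℝ} (G : TimeGrid ε T) : ℝ :=
  ⨆ i : Fin G.N, (G.time (i + 1) - G.time i)

/-- The consistency training loss accumulated over the first `k` steps,
`∑_{i=1}^k E d(f(x₀ + t_i z, t_i, θ), f(x₀ + t_{i-1} z, t_{i-1}, θ'))`, where `x₀ ∼ p₀` and
`z ∼ N(0, I)` are independent; `θm` is the target parameter `θ'`. -/
noncomputable def ctLoss {n : ℕ} {Θ : Type*} {ε T : ℝ} (p0 : Measure (EuclideanSpace ℝ (Fin n)))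
    (d : EuclideanSpace ℝ (Fin n) → EuclideanSpace ℝ (Fin n) → ℝ)
    (f : EuclideanSpace ℝ (Fin n) → ℝ → Θ → EuclideanSpace ℝ (Fin n))
    (θ θm : Θ) (G : TimeGrid ε T) (k : ℕ) : ℝ≥0∞ :=
  ∑ i ∈ Finset.range k,
    ∫⁻ w, ENNReal.ofReal
      (d (f (w.1 + G.time (i + 1) • w.2) (G.time (i + 1)) θ)
        (f (w.1 + G.time i • w.2) (G.time i) θm))
      ∂(p0.prod (stdGaussian (EuclideanSpace ℝ (Fin n))))

/-- `f_t`, the distribution of `f(x_t, t, θ)` for `x_t ∼ q`. -/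
noncomputable def generated {n : ℕ} {Θ : Type*}
    (f : EuclideanSpace ℝ (Fin n) → ℝ → Θ → EuclideanSpace ℝ (Fin n)) (θ : Θ)
    (q : Measure (EuclideanSpace ℝ (Fin n))) (t : ℝ) : Measure (EuclideanSpace ℝ (Fin n)) :=
  q.map (fun x => f x t θ)

/-- `g_t`, the distribution of `g(y_t, t)` for `y_t ∼ p_t`. -/
noncomputable def consistencyLaw {n : ℕ} (p0 : Measure (EuclideanSpace ℝ (Fin n)))
    (g : EuclideanSpace ℝ (Fin n) → ℝ → EuclideanSpace ℝ (Fin n)) (t : ℝ) :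
    Measure (EuclideanSpace ℝ (Fin n)) :=
  (smoothed p0 t).map (fun y => g y t)

end ConsistencyModel

/-!
The inequality and the identity `W[f_t, g_t] = W[f_t, p_ε]` are proved separately.

**The inequality.** The data `a ∼ p₀` and the noise `z ∼ N(0, I)` give one coupling of all the laws
`p_t`, through `a + t z`. Since the model is the identity at time `ε`, the increment
`f(a + t_k z, t_k) - f(a + ε z, ε)` telescopes over the grid, and the mean of its norm is at most
the training loss, because `d` dominates the norm (`wasserstein_generated_le_ctLoss`). Hence
`W[f_# p_t, p_ε]` is bounded by the loss with no discretisation error at all, so that the theorem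
holds with `C = 0` and `R = 0`: comparing along the independent coupling, rather than along the
trajectories of the probability flow, makes both error terms superfluous. The term `L W[q_t, p_t]`
and the term `ε √n` come from the triangle inequality (`wasserstein_triangle`).

**The identity.** What has to be shown is that `g(·, t)` carries `p_t` to `p_ε`
(`consistencyLaw_eq`), for an arbitrary probability measure `p₀`, without moments, and for `ε = 0`
as well. The velocity of the flow is the posterior mean `v(t, x) = E[z | a + t z = x]`
(`neg_smul_score`).

* For `t > 0` it is locally Lipschitz, of linear growth (`exists_norm_velocity_le`), and one-sided
  Lipschitz with constant `1 / t` (`inner_velocity_sub_le`). So there is a global flow on positive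
  times, which is Lipschitz forwards in time.
* The flow carries `p_s` to `p_t` (`map_flow_noised`). From a point `X ∼ p_s`, draw the noise from
  the posterior given `X`, and move to `X + h z`: the new point is exactly distributed according to
  `p_{s+h}` (`map_fst_posteriorStep`). The mean displacement is the Euler step `h v(s, X)`, and the
  fluctuations are uncorrelated, of variance of order `h²`, so after `(t - s) / h` steps they add
  up to order `h`. By the one-sided Lipschitz bound, the chain therefore stays close to the flow
  line through its starting point (`exists_coupling_trackingError_le`), and `h → 0` gives the claim.
* The mean of `‖v(t, ·)‖` under `p_t` is bounded uniformly in `t`, since `E ‖z‖²` is finite. So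
  almost every flow line has finite length and converges as `t → 0`, and the limit is distributed
  according to `p₀` (`map_flowOrigin`).
-/

set_option linter.unusedSectionVars false

namespace ConsistencyModel

/-! ### The velocity field of the probability flow -/

section Bump

variable {E : Type*} [NormedAddCommGroup E] [InnerProductSpace ℝ E]

/-- The unnormalised standard Gaussian density `exp(-‖u‖² / 2)`. -/
noncomputable def bump (u : E) : ℝ := Real.exp (-‖u‖ ^ 2 / 2)

lemma bump_pos (u : E) : 0 < bump u := Real.exp_pos _

lemma bump_le_one (u : E) : bump u ≤ 1 := by
  unfold bump
  rw [Real.exp_le_one_iff]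
  have := sq_nonneg ‖u‖
  linarith

@[fun_prop]
lemma continuous_bump : Continuous (bump : E → ℝ) := by
  unfold bump
  fun_prop

lemma bump_mul_one_add_sq_le (u : E) : bump u * (1 + ‖u‖ ^ 2) ≤ 2 := by
  unfold bump
  have h := Real.add_one_le_exp (‖u‖ ^ 2 / 2)
  have h2 : Real.exp (-‖u‖ ^ 2 / 2) * Real.exp (‖u‖ ^ 2 / 2) = 1 := by
    rw [← Real.exp_add]; simp [neg_div]
  have h3 := Real.exp_pos (-‖u‖ ^ 2 / 2)
  nlinarith

lemma bump_mul_norm_le (u : E) : bump u * ‖u‖ ≤ 1 := by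
  have h := bump_mul_one_add_sq_le u
  have h3 := bump_pos u
  nlinarith [mul_nonneg h3.le (sq_nonneg (‖u‖ - 1))]

lemma norm_bump_smul_le (u : E) : ‖bump u • u‖ ≤ 1 := by
  rw [norm_smul, Real.norm_of_nonneg (bump_pos u).le]
  exact bump_mul_norm_le u

/-- The tail of `‖u‖ exp(-‖u‖² / 2)` is dominated by its value at the cut `m`. -/
lemma bump_mul_norm_le_of_one_le {m : ℝ} (hm : 1 ≤ m) (u : E) :
    bump u * ‖u‖ ≤ m * bump u + m * Real.exp (-m ^ 2 / 2) := by
  have h3 := bump_pos u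
  have h4 := Real.exp_pos (-m ^ 2 / 2)
  rcases le_total ‖u‖ m with h | h
  · nlinarith
  · have key : ‖u‖ * bump u ≤ m * Real.exp (-m ^ 2 / 2) := by
      -- `‖u‖ ≤ m exp(‖u‖ / m - 1)` and `‖u‖ / m - 1 ≤ (‖u‖² - m²) / 2`
      have h5 : ‖u‖ ≤ m * Real.exp (‖u‖ / m - 1) := by
        have := Real.add_one_le_exp (‖u‖ / m - 1)
        have h6 : ‖u‖ = m * (‖u‖ / m) := by field_simp
        calc ‖u‖ = m * (‖u‖ / m) := h6
          _ ≤ _ := by gcongr; linarith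
      have h7 : ‖u‖ / m - 1 ≤ (‖u‖ ^ 2 - m ^ 2) / 2 := by
        rw [sub_le_iff_le_add, div_le_iff₀ (by linarith)]
        nlinarith [mul_nonneg (sub_nonneg.2 h) (sub_nonneg.2 hm), sq_nonneg (‖u‖ - m),
          mul_nonneg (mul_nonneg (sub_nonneg.2 h) (sub_nonneg.2 hm)) (by linarith : (0:ℝ) ≤ ‖u‖),
          mul_nonneg (mul_nonneg (sub_nonneg.2 h) (sub_nonneg.2 hm)) (by linarith : (0:ℝ) ≤ m)]
      calc ‖u‖ * bump u ≤ (m * Real.exp (‖u‖ / m - 1)) * bump u := by gcongr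
        _ ≤ (m * Real.exp ((‖u‖ ^ 2 - m ^ 2) / 2)) * bump u := by gcongr
        _ = m * Real.exp (-m ^ 2 / 2) := by
          unfold bump
          rw [mul_assoc, ← Real.exp_add]; ring_nf
    nlinarith [mul_pos (by linarith : 0 < m) h3]

lemma hasFDerivAt_bump (u : E) : HasFDerivAt (bump : E → ℝ) (-bump u • innerSL ℝ u) u := by
  have h := ((hasStrictFDerivAt_norm_sq u).hasFDerivAt.const_mul (-(1 / 2) : ℝ)).exp
  have e : (fun x : E => Real.exp (-(1 / 2) * ‖x‖ ^ 2)) = bump := by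
    funext x; unfold bump; ring_nf
  rw [e] at h
  refine h.congr_fderiv ?_
  ext y
  simp only [bump, _root_.smul_apply, smul_eq_mul, nsmul_eq_mul]
  ring_nf

lemma lipschitzWith_bump : LipschitzWith 1 (bump : E → ℝ) := by
  refine lipschitzWith_of_nnnorm_fderiv_le (𝕜 := ℝ)
    (fun u => (hasFDerivAt_bump u).differentiableAt) fun u => ?_
  rw [(hasFDerivAt_bump u).fderiv, ← NNReal.coe_le_coe, coe_nnnorm, norm_smul,
    innerSL_apply_norm, norm_neg, Real.norm_of_nonneg (bump_pos u).le]
  exact bump_mul_norm_le u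

lemma lipschitzWith_bump_smul : LipschitzWith 2 (fun u : E => bump u • u) := by
  have hd (u : E) := (hasFDerivAt_bump u).smul (hasFDerivAt_id u)
  refine lipschitzWith_of_nnnorm_fderiv_le (𝕜 := ℝ) (fun u => (hd u).differentiableAt) fun u => ?_
  rw [← NNReal.coe_le_coe, coe_nnnorm]
  have := (hd u).fderiv
  simp only [id] at this
  erw [this]
  refine ContinuousLinearMap.opNorm_le_bound _ (by simp) fun y => ?_
  have h1 := bump_pos u
  have h2 := bump_mul_one_add_sq_le u
  calc _ = ‖bump u • y + (-bump u * inner ℝ u y) • u‖ := by simp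
    _ ≤ bump u * ‖y‖ + bump u * (‖u‖ * ‖y‖) * ‖u‖ := by
      refine (norm_add_le _ _).trans ?_
      rw [norm_smul, norm_smul, norm_mul, norm_neg, Real.norm_of_nonneg h1.le]
      gcongr
      exact abs_real_inner_le_norm u y
    _ = (bump u * (1 + ‖u‖ ^ 2)) * ‖y‖ := by ring
    _ ≤ _ := by gcongr; simpa using h2

end Bump

section Velocity

variable {E : Type*} [NormedAddCommGroup E] [InnerProductSpace ℝ E] [FiniteDimensional ℝ E]
  [MeasurableSpace E] [BorelSpace E] (p0 : Measure E) [IsProbabilityMeasure p0]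

/-- The noise `z` for which `a + t z = x`. -/
noncomputable def noise (t : ℝ) (x a : E) : E := t⁻¹ • (x - a)

/-- The density of `p_t` at `x`, up to the normalising constant of the Gaussian. -/
noncomputable def partitionFn (t : ℝ) (x : E) : ℝ := ∫ a, bump (noise t x a) ∂p0

/-- The first moment of the noise under the unnormalised posterior at `x`. -/
noncomputable def noiseMoment (t : ℝ) (x : E) : E :=
  ∫ a, bump (noise t x a) • noise t x a ∂p0

/-- The velocity of the probability flow, as the posterior mean `E[z | a + t z = x]` of the
noise. -/
noncomputable def velocity (t : ℝ) (x : E) : E := (partitionFn p0 t x)⁻¹ • noiseMoment p0 t x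

@[fun_prop]
lemma measurable_noise (t : ℝ) (x : E) : Measurable (noise t x) := by
  unfold noise; fun_prop

lemma integrable_bump_noise (t : ℝ) (x : E) : Integrable (fun a => bump (noise t x a)) p0 := by
  refine Integrable.of_bound (C := 1) (by fun_prop) (ae_of_all _ fun a => ?_)
  rw [Real.norm_of_nonneg (bump_pos _).le]
  exact bump_le_one _

lemma integrable_bump_smul_noise (t : ℝ) (x : E) :
    Integrable (fun a => bump (noise t x a) • noise t x a) p0 :=
  Integrable.of_bound (C := 1) (by fun_prop) (ae_of_all _ fun a => norm_bump_smul_le _)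

lemma partitionFn_pos (t : ℝ) (x : E) : 0 < partitionFn p0 t x := by
  unfold partitionFn
  rw [integral_pos_iff_support_of_nonneg (fun a => (bump_pos _).le) (integrable_bump_noise p0 t x)]
  have : (Function.support fun a => bump (noise t x a)) = Set.univ := by
    ext a; simpa using (bump_pos _).ne'
  simp [this]

lemma partitionFn_smul_velocity (t : ℝ) (x : E) :
    partitionFn p0 t x • velocity p0 t x = noiseMoment p0 t x := by
  rw [velocity, smul_smul, mul_inv_cancel₀ (partitionFn_pos p0 t x).ne', one_smul]

lemma continuousOn_noise (a : E) :
    ContinuousOn (fun p : ℝ × E => noise p.1 p.2 a) (Set.Ioi 0 ×ˢ Set.univ) := by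
  unfold noise
  refine ContinuousOn.smul (ContinuousOn.inv₀ (by fun_prop) ?_) (by fun_prop)
  rintro ⟨t, x⟩ ⟨ht, -⟩
  exact (ne_of_gt ht)

lemma continuousOn_partitionFn :
    ContinuousOn (fun p : ℝ × E => partitionFn p0 p.1 p.2) (Set.Ioi 0 ×ˢ Set.univ) := by
  refine continuousOn_of_dominated (bound := fun _ => 1) (fun p _ => by fun_prop) ?_
    (integrable_const _) (ae_of_all _ fun a => ?_)
  · refine fun p _ => ae_of_all _ fun a => ?_
    rw [Real.norm_of_nonneg (bump_pos _).le]
    exact bump_le_one _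
  · exact continuous_bump.comp_continuousOn (continuousOn_noise a)

lemma continuousOn_noiseMoment :
    ContinuousOn (fun p : ℝ × E => noiseMoment p0 p.1 p.2) (Set.Ioi 0 ×ˢ Set.univ) := by
  refine continuousOn_of_dominated (bound := fun _ => 1) (fun p _ => by fun_prop)
    (fun p _ => ae_of_all _ fun a => norm_bump_smul_le _)
    (integrable_const _) (ae_of_all _ fun a => ?_)
  exact (continuous_bump.comp_continuousOn (continuousOn_noise a)).smul (continuousOn_noise a)

lemma continuousOn_velocity :
    ContinuousOn (fun p : ℝ × E => velocity p0 p.1 p.2) (Set.Ioi 0 ×ˢ Set.univ) :=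
  ((continuousOn_partitionFn p0).inv₀ fun p _ => (partitionFn_pos p0 p.1 p.2).ne').smul
    (continuousOn_noiseMoment p0)

lemma dist_noise {t : ℝ} (ht : 0 < t) (x y a : E) :
    ‖noise t x a - noise t y a‖ = t⁻¹ * ‖x - y‖ := by
  simp only [noise, ← smul_sub, norm_smul, sub_sub_sub_cancel_right]
  rw [Real.norm_of_nonneg (by positivity)]

lemma norm_partitionFn_sub_le {t : ℝ} (ht : 0 < t) (x y : E) :
    ‖partitionFn p0 t x - partitionFn p0 t y‖ ≤ t⁻¹ * ‖x - y‖ := by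
  unfold partitionFn
  rw [← integral_sub (integrable_bump_noise p0 t x) (integrable_bump_noise p0 t y)]
  refine (norm_integral_le_of_norm_le_const (C := t⁻¹ * ‖x - y‖) (ae_of_all _ fun a => ?_)).trans
    (by simp)
  simpa [dist_noise ht] using lipschitzWith_bump.norm_sub_le (noise t x a) (noise t y a)

lemma norm_noiseMoment_sub_le {t : ℝ} (ht : 0 < t) (x y : E) :
    ‖noiseMoment p0 t x - noiseMoment p0 t y‖ ≤ 2 * (t⁻¹ * ‖x - y‖) := by
  unfold noiseMoment
  rw [← integral_sub (integrable_bump_smul_noise p0 t x) (integrable_bump_smul_noise p0 t y)]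
  refine (norm_integral_le_of_norm_le_const (C := 2 * (t⁻¹ * ‖x - y‖))
    (ae_of_all _ fun a => ?_)).trans (by simp)
  simpa [dist_noise ht] using lipschitzWith_bump_smul.norm_sub_le (noise t x a) (noise t y a)

/-- On compact subsets of `(0, ∞) × E` the velocity is Lipschitz in space, uniformly in time. -/
lemma exists_lipschitzOnWith_velocity {α β : ℝ} (hα : 0 < α) (ρ : ℝ) :
    ∃ K : NNReal, ∀ t ∈ Set.Icc α β,
      LipschitzOnWith K (velocity p0 t) (Metric.closedBall 0 ρ) := by
  have hc : IsCompact (Set.Icc α β ×ˢ Metric.closedBall (0 : E) ρ) :=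
    isCompact_Icc.prod (isCompact_closedBall _ _)
  have hsub : Set.Icc α β ×ˢ Metric.closedBall (0 : E) ρ ⊆ Set.Ioi 0 ×ˢ Set.univ :=
    fun p hp => ⟨hα.trans_le hp.1.1, trivial⟩
  obtain ⟨A, hA⟩ := hc.exists_bound_of_continuousOn ((continuousOn_velocity p0).mono hsub)
  obtain ⟨B, hB⟩ := hc.exists_bound_of_continuousOn
    (((continuousOn_partitionFn p0).inv₀ fun p _ => (partitionFn_pos p0 p.1 p.2).ne').mono hsub)
  -- `v x - v y = Z(x)⁻¹ (N x - N y - (Z x - Z y) v y)`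
  refine ⟨Real.toNNReal (B * ((2 + A) * α⁻¹)), fun t ht => LipschitzOnWith.of_dist_le_mul ?_⟩
  intro x hx y hy
  have ht0 : 0 < t := hα.trans_le ht.1
  have hAy := hA (t, y) ⟨ht, hy⟩
  have hBx := hB (t, x) ⟨ht, hx⟩
  simp only [Pi.inv_apply] at hAy hBx
  have hA0 : 0 ≤ A := (norm_nonneg _).trans hAy
  have hB0 : 0 ≤ B := (norm_nonneg _).trans hBx
  rw [Real.coe_toNNReal _ (by positivity), dist_eq_norm, dist_eq_norm]
  have e : velocity p0 t x - velocity p0 t y = (partitionFn p0 t x)⁻¹ •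
      ((noiseMoment p0 t x - noiseMoment p0 t y) -
        (partitionFn p0 t x - partitionFn p0 t y) • velocity p0 t y) := by
    rw [sub_smul, partitionFn_smul_velocity, sub_sub_sub_cancel_right, smul_sub, smul_smul,
      inv_mul_cancel₀ (partitionFn_pos p0 t x).ne', one_smul]
    rfl
  rw [e, norm_smul, mul_assoc]
  have hti : t⁻¹ ≤ α⁻¹ := inv_anti₀ hα ht.1
  gcongr
  calc _ ≤ 2 * (t⁻¹ * ‖x - y‖) + (t⁻¹ * ‖x - y‖) * A := by
        refine (norm_sub_le _ _).trans ?_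
        rw [norm_smul]
        gcongr
        · exact norm_noiseMoment_sub_le p0 ht0 x y
        · exact norm_partitionFn_sub_le p0 ht0 x y
    _ = (2 + A) * t⁻¹ * ‖x - y‖ := by ring
    _ ≤ _ := by gcongr

lemma exists_lt_measureReal_closedBall (μ : Measure E) [IsProbabilityMeasure μ] {θ : ℝ}
    (hθ : θ < 1) : ∃ k : ℕ, θ < μ.real (Metric.closedBall 0 k) := by
  have h : Tendsto (fun k : ℕ => μ.real (Metric.closedBall (0 : E) k)) atTop (𝓝 1) := by
    have hm : Monotone fun k : ℕ => Metric.closedBall (0 : E) k :=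
      fun i j hij => Metric.closedBall_subset_closedBall (by exact_mod_cast hij)
    have := tendsto_measure_iUnion_atTop (μ := μ) hm
    rw [Metric.iUnion_closedBall_nat, measure_univ] at this
    exact (ENNReal.tendsto_toReal ENNReal.one_ne_top).comp this
  exact (h.eventually (lt_mem_nhds hθ)).exists

/-- The velocity grows at most linearly, with no moment assumption on `p0`: if a ball of radius
`ρ` carries half of the mass of `p0`, then posterior mass outside radius `‖x‖ + ρ` is negligible. -/
lemma exists_norm_velocity_le :
    ∃ ρ : ℝ, 0 ≤ ρ ∧ ∀ t : ℝ, 0 < t → ∀ x, ‖velocity p0 t x‖ ≤ 3 * (1 + (‖x‖ + ρ) / t) := by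
  obtain ⟨ρ, hρ0, hρ⟩ : ∃ ρ : ℝ, 0 ≤ ρ ∧ 1 / 2 ≤ p0.real (Metric.closedBall 0 ρ) := by
    obtain ⟨k, hk⟩ := exists_lt_measureReal_closedBall p0 (by norm_num : (1 / 2 : ℝ) < 1)
    exact ⟨k, by positivity, hk.le⟩
  refine ⟨ρ, hρ0, fun t ht x => ?_⟩
  set m := 1 + (‖x‖ + ρ) / t with hm
  have hq : 0 ≤ (‖x‖ + ρ) / t := by positivity
  have hm1 : 1 ≤ m := by linarith
  have hZ := partitionFn_pos p0 t x
  have hlow : Real.exp (-m ^ 2 / 2) ≤ 2 * partitionFn p0 t x := by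
    have h1 : ∀ a ∈ Metric.closedBall (0 : E) ρ, Real.exp (-m ^ 2 / 2) ≤ bump (noise t x a) := by
      intro a ha
      have ha' : ‖a‖ ≤ ρ := by simpa using ha
      have h2 : ‖noise t x a‖ ≤ m := by
        rw [noise, norm_smul, Real.norm_of_nonneg (by positivity), ← div_eq_inv_mul]
        have : ‖x - a‖ / t ≤ (‖x‖ + ρ) / t := by
          gcongr; exact (norm_sub_le _ _).trans (by gcongr)
        linarith
      unfold bump
      gcongr
    have h3 : ∫ a in Metric.closedBall (0 : E) ρ, Real.exp (-m ^ 2 / 2) ∂p0 ≤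
        partitionFn p0 t x := by
      refine (setIntegral_mono_on (integrable_const _).integrableOn
        (integrable_bump_noise p0 t x).integrableOn Metric.isClosed_closedBall.measurableSet
        h1).trans ?_
      exact setIntegral_le_integral (integrable_bump_noise p0 t x)
        (ae_of_all _ fun a => (bump_pos _).le)
    rw [setIntegral_const, smul_eq_mul] at h3
    have := Real.exp_pos (-m ^ 2 / 2)
    nlinarith
  have hN : ‖noiseMoment p0 t x‖ ≤ m * partitionFn p0 t x + m * Real.exp (-m ^ 2 / 2) := by
    unfold noiseMoment partitionFn
    refine (norm_integral_le_integral_norm _).trans ?_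
    rw [← integral_const_mul]
    have : m * Real.exp (-m ^ 2 / 2) = ∫ _, m * Real.exp (-m ^ 2 / 2) ∂p0 := by simp
    rw [this, ← integral_add ((integrable_bump_noise p0 t x).const_mul _) (integrable_const _)]
    refine integral_mono (integrable_bump_smul_noise p0 t x).norm
      (((integrable_bump_noise p0 t x).const_mul _).add (integrable_const _)) fun a => ?_
    simp only [norm_smul, Real.norm_of_nonneg (bump_pos (noise t x a)).le]
    exact bump_mul_norm_le_of_one_le hm1 _
  rw [velocity, norm_smul, norm_inv, Real.norm_of_nonneg hZ.le, inv_mul_le_iff₀ hZ]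
  nlinarith

/-- One-sided Lipschitz bound: `x ↦ x - t v(t, x) = E[a | a + t z = x]` is monotone, being the
gradient of a log-Laplace transform. -/
lemma inner_velocity_sub_le {t : ℝ} (ht : 0 < t) (x y : E) :
    inner ℝ (velocity p0 t x - velocity p0 t y) (x - y) ≤ t⁻¹ * ‖x - y‖ ^ 2 := by
  set Zx := partitionFn p0 t x
  set Zy := partitionFn p0 t y
  have hZx : 0 < Zx := partitionFn_pos p0 t x
  have hZy : 0 < Zy := partitionFn_pos p0 t y
  -- the gap of the inequality is the integral of `q` over `p0 ⊗ p0`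
  let q : E × E → ℝ := fun w => bump (noise t x w.1) * bump (noise t y w.2) *
    inner ℝ (t⁻¹ • (w.1 - w.2)) (x - y)
  have hnoise : ∀ a b : E, noise t x a - noise t y b = t⁻¹ • (x - y) - t⁻¹ • (a - b) := by
    intro a b; simp only [noise, ← smul_sub]; congr 1; abel
  have hqe : ∀ w, q w = t⁻¹ * ‖x - y‖ ^ 2 * (bump (noise t x w.1) * bump (noise t y w.2)) -
      (inner ℝ (bump (noise t x w.1) • noise t x w.1) (x - y) * bump (noise t y w.2) -
        bump (noise t x w.1) * inner ℝ (bump (noise t y w.2) • noise t y w.2) (x - y)) := by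
    intro w
    have : t⁻¹ • (w.1 - w.2) = t⁻¹ • (x - y) - (noise t x w.1 - noise t y w.2) := by
      rw [hnoise]; abel
    simp only [q]
    rw [this, inner_sub_left, inner_sub_left (noise t x w.1), real_inner_smul_left,
      real_inner_smul_left, real_inner_smul_left, real_inner_self_eq_norm_sq]
    ring
  have hix := integrable_bump_noise p0 t x
  have hiy := integrable_bump_noise p0 t y
  have hjx : Integrable (fun a => inner ℝ (bump (noise t x a) • noise t x a) (x - y)) p0 :=
    (integrable_bump_smul_noise p0 t x).inner_const _
  have hjy : Integrable (fun a => inner ℝ (bump (noise t y a) • noise t y a) (x - y)) p0 :=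
    (integrable_bump_smul_noise p0 t y).inner_const _
  have hi1 := (hix.mul_prod hiy).const_mul (t⁻¹ * ‖x - y‖ ^ 2)
  have hi2 := hjx.mul_prod hiy
  have hi3 := hix.mul_prod hjy
  have hqi : Integrable q (p0.prod p0) := by
    refine (hi1.sub (hi2.sub hi3)).congr (ae_of_all _ fun w => ?_)
    rw [hqe]; rfl
  have hNx : ∫ a, inner ℝ (bump (noise t x a) • noise t x a) (x - y) ∂p0 =
      Zx * inner ℝ (velocity p0 t x) (x - y) := by
    rw [← real_inner_smul_left, partitionFn_smul_velocity, noiseMoment, real_inner_comm,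
      ← integral_inner (integrable_bump_smul_noise p0 t x)]
    simp_rw [real_inner_comm (x - y)]
  have hNy : ∫ a, inner ℝ (bump (noise t y a) • noise t y a) (x - y) ∂p0 =
      Zy * inner ℝ (velocity p0 t y) (x - y) := by
    rw [← real_inner_smul_left, partitionFn_smul_velocity, noiseMoment, real_inner_comm,
      ← integral_inner (integrable_bump_smul_noise p0 t y)]
    simp_rw [real_inner_comm (x - y)]
  have hval : ∫ w, q w ∂(p0.prod p0) = Zx * Zy * (t⁻¹ * ‖x - y‖ ^ 2 -
      inner ℝ (velocity p0 t x - velocity p0 t y) (x - y)) := by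
    simp_rw [hqe]
    have e1 := integral_sub hi1 (hi2.sub hi3)
    have e2 := integral_sub hi2 hi3
    simp only [Pi.sub_apply] at e1 e2
    have e3 := integral_prod_mul (μ := p0) (ν := p0) (fun a => bump (noise t x a))
      fun b => bump (noise t y b)
    have e4 := integral_prod_mul (μ := p0) (ν := p0)
      (fun a => inner ℝ (bump (noise t x a) • noise t x a) (x - y)) fun b => bump (noise t y b)
    have e5 := integral_prod_mul (μ := p0) (ν := p0) (fun a => bump (noise t x a))
      fun b => inner ℝ (bump (noise t y b) • noise t y b) (x - y)
    rw [e1, e2, integral_const_mul, e3, e4, e5, hNx, hNy, inner_sub_left]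
    simp only [Zx, Zy, partitionFn]
    ring
  have hsym : ∫ w, q w ∂(p0.prod p0) = ∫ w, q w.swap ∂(p0.prod p0) :=
    (integral_prod_swap q).symm
  have hpos : 0 ≤ ∫ w, (q w + q w.swap) ∂(p0.prod p0) := by
    refine integral_nonneg fun w => ?_
    obtain ⟨a, b⟩ := w
    -- swapping `a` and `b` changes the weight by the factor `exp ⟪a - b, x - y⟫ / t²`
    set s := inner ℝ (t⁻¹ • (a - b)) (x - y) with hs
    have hs' : inner ℝ (t⁻¹ • (b - a)) (x - y) = -s := by
      rw [hs, ← inner_neg_left, ← smul_neg, neg_sub]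
    have hw : bump (noise t x a) * bump (noise t y b) =
        bump (noise t x b) * bump (noise t y a) * Real.exp (t⁻¹ * s) := by
      simp only [bump, ← Real.exp_add]
      congr 1
      simp only [noise, norm_smul, mul_pow, hs, real_inner_smul_left, norm_sub_sq_real,
        inner_sub_left, inner_sub_right, Real.norm_eq_abs, sq_abs, real_inner_comm a,
        real_inner_comm b]
      ring
    simp only [q, Prod.swap, hs', Pi.zero_apply, ← hs, hw]
    have hB : 0 < bump (noise t x b) * bump (noise t y a) := mul_pos (bump_pos _) (bump_pos _)
    have hti : 0 < t⁻¹ := by positivity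
    have : 0 ≤ s * (Real.exp (t⁻¹ * s) - 1) := by
      rcases le_total 0 s with h | h
      · exact mul_nonneg h (sub_nonneg.2 (Real.one_le_exp (by positivity)))
      · exact mul_nonneg_of_nonpos_of_nonpos h
          (sub_nonpos.2 (Real.exp_le_one_iff.2 (mul_nonpos_of_nonneg_of_nonpos hti.le h)))
    nlinarith
  have e3 := integral_add hqi hqi.swap
  simp only [Function.comp_apply] at e3
  rw [e3, ← hsym, hval] at hpos
  have : 0 < Zx * Zy := mul_pos hZx hZy
  by_contra hcon
  push Not at hcon
  nlinarith

end Velocity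

section Score

variable {n : ℕ} (p0 : Measure (EuclideanSpace ℝ (Fin n))) [IsProbabilityMeasure p0]

lemma hasGradientAt_partitionFn {t : ℝ} (ht : 0 < t) (x : EuclideanSpace ℝ (Fin n)) :
    HasGradientAt (partitionFn p0 t) (-(t⁻¹ • noiseMoment p0 t x)) x := by
  rw [hasGradientAt_iff_hasFDerivAt]
  have hn (a y : EuclideanSpace ℝ (Fin n)) : HasFDerivAt (fun y => noise t y a)
      (t⁻¹ • ContinuousLinearMap.id ℝ (EuclideanSpace ℝ (Fin n))) y :=
    ((hasFDerivAt_id y).sub_const a).const_smul t⁻¹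
  have h := hasFDerivAt_integral_of_dominated_of_fderiv_le (μ := p0) (𝕜 := ℝ)
    (F := fun y a => bump (noise t y a))
    (F' := fun y a => innerSL ℝ ((-t⁻¹) • (bump (noise t y a) • noise t y a)))
    (x₀ := x) (s := Set.univ) (bound := fun _ => t⁻¹) univ_mem
    (Eventually.of_forall fun y => by fun_prop) (integrable_bump_noise p0 t x)
    ((innerSL ℝ).continuous.comp_aestronglyMeasurable (by fun_prop))
    (ae_of_all _ fun a y _ => ?_) (integrable_const _) (ae_of_all _ fun a y _ => ?_)
  · refine h.congr_fderiv ?_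
    have e := ContinuousLinearMap.integral_comp_comm (innerSL ℝ)
      ((integrable_bump_smul_noise p0 t x).smul (-t⁻¹))
    simp only [Pi.smul_apply] at e
    rw [e, integral_smul]
    ext y
    rw [innerSL_apply_apply, InnerProductSpace.toDual_apply_apply, noiseMoment, neg_smul]
  · rw [innerSL_apply_norm, norm_smul, norm_neg, Real.norm_of_nonneg (by positivity)]
    exact mul_le_of_le_one_right (by positivity) (norm_bump_smul_le _)
  · refine ((hasFDerivAt_bump (noise t y a)).comp y (hn a y)).congr_fderiv ?_
    ext z
    simp

lemma smoothedDensity_eq {t : ℝ} (x : EuclideanSpace ℝ (Fin n)) :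
    smoothedDensity p0 t x = (2 * Real.pi * t ^ 2) ^ (-(n : ℝ) / 2) * partitionFn p0 t x := by
  rw [smoothedDensity, partitionFn, ← integral_const_mul]
  congr with a
  simp only [bump, noise, norm_smul, mul_pow, norm_inv, inv_pow, Real.norm_eq_abs, sq_abs]
  congr 2
  rw [mul_comm (2 : ℝ), ← div_div, neg_div, neg_div, neg_div, div_eq_inv_mul (‖x - a‖ ^ 2)]

/-- The right-hand side of the probability-flow equation is the posterior mean of the noise
(Tweedie's formula). -/
lemma neg_smul_score {t : ℝ} (ht : 0 < t) (x : EuclideanSpace ℝ (Fin n)) :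
    -(t • score p0 t x) = velocity p0 t x := by
  have hZ := partitionFn_pos p0 t x
  set c := (2 * Real.pi * t ^ 2) ^ (-(n : ℝ) / 2)
  have hc : 0 < c := by positivity
  have h1 : HasFDerivAt (fun y => Real.log (smoothedDensity p0 t y))
      ((c * partitionFn p0 t x)⁻¹ • (c • InnerProductSpace.toDual ℝ _
        (-(t⁻¹ • noiseMoment p0 t x)))) x := by
    simp_rw [smoothedDensity_eq]
    exact ((hasGradientAt_iff_hasFDerivAt.1 (hasGradientAt_partitionFn p0 ht x)).const_mul c).log
      (by positivity)
  have h2 : HasGradientAt (fun y => Real.log (smoothedDensity p0 t y))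
      ((partitionFn p0 t x)⁻¹ • (-(t⁻¹ • noiseMoment p0 t x))) x := by
    rw [hasGradientAt_iff_hasFDerivAt]
    refine h1.congr_fderiv ?_
    rw [map_smul, smul_smul]
    congr 1
    field_simp
  rw [score, h2.gradient, velocity, smul_neg, smul_neg, neg_neg, smul_smul, smul_smul]
  congr 1
  field_simp

end Score

/-! ### Global existence and uniqueness for equations of linear growth -/

section ODE

variable {E : Type*} [NormedAddCommGroup E] [InnerProductSpace ℝ E]

/-- The radial retraction onto the closed ball of radius `ρ`. -/
noncomputable def radialRetract (ρ : ℝ) (x : E) : E := (ρ / max ρ ‖x‖) • x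

lemma radialRetract_of_norm_le {ρ : ℝ} (hρ : 0 < ρ) {x : E} (hx : ‖x‖ ≤ ρ) :
    radialRetract ρ x = x := by
  rw [radialRetract, max_eq_left hx, div_self hρ.ne', one_smul]

lemma norm_radialRetract {ρ : ℝ} (hρ : 0 < ρ) (x : E) :
    ‖radialRetract ρ x‖ = ρ / max ρ ‖x‖ * ‖x‖ := by
  rw [radialRetract, norm_smul, Real.norm_of_nonneg (by positivity)]

lemma norm_radialRetract_le {ρ : ℝ} (hρ : 0 < ρ) (x : E) : ‖radialRetract ρ x‖ ≤ ρ := by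
  have hm : 0 < max ρ ‖x‖ := lt_max_of_lt_left hρ
  rw [norm_radialRetract hρ, div_mul_eq_mul_div, div_le_iff₀ hm]
  gcongr
  exact le_max_right _ _

lemma norm_radialRetract_le_norm {ρ : ℝ} (hρ : 0 < ρ) (x : E) : ‖radialRetract ρ x‖ ≤ ‖x‖ := by
  have hm : 0 < max ρ ‖x‖ := lt_max_of_lt_left hρ
  rw [norm_radialRetract hρ]
  exact mul_le_of_le_one_left (norm_nonneg _) ((div_le_one hm).2 (le_max_left _ _))

lemma lipschitzWith_radialRetract {ρ : ℝ} (hρ : 0 < ρ) :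
    LipschitzWith 2 (radialRetract ρ : E → E) := by
  refine LipschitzWith.of_dist_le_mul fun x y => ?_
  set a := max ρ ‖x‖ with ha
  set b := max ρ ‖y‖ with hb
  have ha0 : 0 < a := lt_max_of_lt_left hρ
  have hb0 : 0 < b := lt_max_of_lt_left hρ
  have hab : |b - a| ≤ ‖x - y‖ := by
    refine (abs_max_sub_max_le_max ρ ‖y‖ ρ ‖x‖).trans ?_
    rw [sub_self, abs_zero, max_eq_right (abs_nonneg _), abs_sub_comm]
    exact abs_norm_sub_norm_le x y
  have e : radialRetract ρ x - radialRetract ρ y =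
      (ρ / a) • (x - y) + (ρ / a * ((b - a) / b)) • y := by
    have h1 : ρ / b = ρ / a - ρ / a * ((b - a) / b) := by field_simp; ring
    rw [radialRetract, radialRetract, ← ha, ← hb, h1]
    module
  rw [dist_eq_norm, dist_eq_norm, e]
  have h2 : ρ / a ≤ 1 := (div_le_one ha0).2 (le_max_left _ _)
  have h3 : 0 ≤ ρ / a := by positivity
  refine (norm_add_le _ _).trans ?_
  rw [norm_smul, norm_smul, norm_mul, norm_div (b - a), Real.norm_of_nonneg h3,
    Real.norm_of_nonneg hb0.le, Real.norm_eq_abs]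
  have h4 : |b - a| / b * ‖y‖ ≤ ‖x - y‖ := by
    rw [div_mul_eq_mul_div, div_le_iff₀ hb0]
    gcongr
    exact le_max_right _ _
  have h5 : 0 ≤ |b - a| / b * ‖y‖ := by positivity
  simp only [NNReal.coe_ofNat]
  nlinarith [norm_nonneg (x - y)]

/-- A curve whose speed is at most `A (1 + ‖x‖)` stays bounded, both forwards and backwards in
time, because `log (1 + ‖x‖²)` is Lipschitz along it. -/
lemma one_add_norm_sq_le_of_linear_growth {x w : ℝ → E} {α β A t₀ t : ℝ} (hA : 0 ≤ A)
    (hx : ∀ t ∈ Set.Icc α β, HasDerivWithinAt x (w t) (Set.Icc α β) t)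
    (hw : ∀ t ∈ Set.Icc α β, ‖w t‖ ≤ A * (1 + ‖x t‖)) (ht₀ : t₀ ∈ Set.Icc α β)
    (ht : t ∈ Set.Icc α β) :
    1 + ‖x t‖ ^ 2 ≤ (1 + ‖x t₀‖ ^ 2) * Real.exp (4 * A * (β - α)) := by
  have hpos : ∀ t, 0 < 1 + ‖x t‖ ^ 2 := fun t => by positivity
  have hd : ∀ t ∈ Set.Icc α β, HasDerivWithinAt (fun t => Real.log (1 + ‖x t‖ ^ 2))
      (2 * inner ℝ (x t) (w t) / (1 + ‖x t‖ ^ 2)) (Set.Icc α β) t := fun t ht =>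
    ((hx t ht).norm_sq.const_add 1).log (hpos t).ne'
  have hb : ∀ t ∈ Set.Icc α β, ‖2 * inner ℝ (x t) (w t) / (1 + ‖x t‖ ^ 2)‖ ≤ 4 * A := by
    intro t ht
    rw [norm_div, Real.norm_of_nonneg (hpos t).le, div_le_iff₀ (hpos t), norm_mul,
      Real.norm_of_nonneg (by norm_num : (0 : ℝ) ≤ 2)]
    have h1 : ‖inner ℝ (x t) (w t)‖ ≤ ‖x t‖ * (A * (1 + ‖x t‖)) :=
      (norm_inner_le_norm _ _).trans (by gcongr; exact hw t ht)
    have h2 : ‖x t‖ * (1 + ‖x t‖) ≤ 2 * (1 + ‖x t‖ ^ 2) := by nlinarith [sq_nonneg (‖x t‖ - 1)]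
    nlinarith [mul_le_mul_of_nonneg_left h2 hA]
  have h := (convex_Icc α β).norm_image_sub_le_of_norm_hasDerivWithin_le hd hb ht₀ ht
  have h3 : ‖t - t₀‖ ≤ β - α := by
    rw [Real.norm_eq_abs, abs_le]
    constructor <;> linarith [ht.1, ht.2, ht₀.1, ht₀.2]
  have h4 : Real.log (1 + ‖x t‖ ^ 2) ≤ Real.log (1 + ‖x t₀‖ ^ 2) + 4 * A * (β - α) := by
    have := (le_abs_self _).trans (h.trans (mul_le_mul_of_nonneg_left h3 (by positivity)))
    linarith
  calc 1 + ‖x t‖ ^ 2 = Real.exp (Real.log (1 + ‖x t‖ ^ 2)) := (Real.exp_log (hpos t)).symm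
    _ ≤ Real.exp (Real.log (1 + ‖x t₀‖ ^ 2) + 4 * A * (β - α)) := Real.exp_le_exp.2 h4
    _ = _ := by rw [Real.exp_add, Real.exp_log (hpos t₀)]

/-- A vector field that is Lipschitz on balls and of linear growth has solutions on every compact
time interval, through every point. The field is truncated outside a ball which the a priori bound
keeps the solution from leaving. -/
theorem exists_solution_of_linear_growth [CompleteSpace E] {v : ℝ → E → E} {α β A t₀ : ℝ}
    (hA : 0 ≤ A)
    (hlip : ∀ ρ : ℝ, ∃ K : NNReal, ∀ t ∈ Set.Icc α β, LipschitzOnWith K (v t)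
      (Metric.closedBall 0 ρ))
    (hcont : ∀ x, ContinuousOn (fun t => v t x) (Set.Icc α β))
    (hgrow : ∀ t ∈ Set.Icc α β, ∀ x, ‖v t x‖ ≤ A * (1 + ‖x‖))
    (ht₀ : t₀ ∈ Set.Icc α β) (y : E) :
    ∃ x : ℝ → E, x t₀ = y ∧
      ∀ t ∈ Set.Icc α β, HasDerivWithinAt x (v t (x t)) (Set.Icc α β) t := by
  have hαβ : 0 ≤ β - α := by linarith [ht₀.1, ht₀.2]
  set B := (1 + ‖y‖ ^ 2) * Real.exp (4 * A * (β - α)) with hB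
  have hB0 : 0 < B := by positivity
  set ρ := √B with hρ
  have hρ0 : 0 < ρ := Real.sqrt_pos.2 hB0
  obtain ⟨K, hK⟩ := hlip ρ
  have hM : 0 ≤ A * (1 + ρ) := by positivity
  have hpl : IsPicardLindelof (fun t x => v t (radialRetract ρ x)) (⟨t₀, ht₀⟩ : Set.Icc α β) y
      (Real.toNNReal (A * (1 + ρ) * (β - α))) 0 (Real.toNNReal (A * (1 + ρ))) (K * 2) := by
    refine ⟨fun t ht => ?_, fun x _ => hcont _, fun t ht x _ => ?_, ?_⟩
    · exact (hK t ht).comp (lipschitzWith_radialRetract hρ0).lipschitzOnWith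
        fun x _ => by simpa using norm_radialRetract_le hρ0 x
    · rw [Real.coe_toNNReal _ hM]
      exact (hgrow t ht _).trans (by gcongr; exact norm_radialRetract_le hρ0 x)
    · rw [Real.coe_toNNReal _ hM, Real.coe_toNNReal _ (by positivity), NNReal.coe_zero, sub_zero]
      gcongr
      exact max_le (by linarith [ht₀.1]) (by linarith [ht₀.2])
  obtain ⟨x, hx0, hx⟩ := hpl.exists_eq_forall_mem_Icc_hasDerivWithinAt₀
  refine ⟨x, hx0, fun t ht => ?_⟩
  have hbound : ‖x t‖ ≤ ρ := by
    have := one_add_norm_sq_le_of_linear_growth hA hx (fun t ht => (hgrow t ht _).trans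
      (by gcongr; exact norm_radialRetract_le_norm hρ0 _)) ht₀ ht
    simp only at hx0
    rw [hx0, ← hB] at this
    exact Real.le_sqrt_of_sq_le (by linarith)
  have := hx t ht
  rwa [radialRetract_of_norm_le hρ0 hbound] at this

theorem solution_unique_of_lipschitz_on_balls {v : ℝ → E → E} {α β t₀ : ℝ}
    (hlip : ∀ ρ : ℝ, ∃ K : NNReal, ∀ t ∈ Set.Icc α β, LipschitzOnWith K (v t)
      (Metric.closedBall 0 ρ))
    (ht₀ : t₀ ∈ Set.Icc α β) {x y : ℝ → E}
    (hx : ∀ t ∈ Set.Icc α β, HasDerivWithinAt x (v t (x t)) (Set.Icc α β) t)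
    (hy : ∀ t ∈ Set.Icc α β, HasDerivWithinAt y (v t (y t)) (Set.Icc α β) t)
    (h0 : x t₀ = y t₀) : Set.EqOn x y (Set.Icc α β) := by
  have hxc : ContinuousOn x (Set.Icc α β) := fun t ht => (hx t ht).continuousWithinAt
  have hyc : ContinuousOn y (Set.Icc α β) := fun t ht => (hy t ht).continuousWithinAt
  obtain ⟨B, hB⟩ := isCompact_Icc.exists_bound_of_continuousOn hxc
  obtain ⟨B', hB'⟩ := isCompact_Icc.exists_bound_of_continuousOn hyc
  obtain ⟨K, hK⟩ := hlip (max B B')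
  have hxm : ∀ t ∈ Set.Icc α β, x t ∈ Metric.closedBall (0 : E) (max B B') := fun t ht => by
    simpa using Or.inl (hB t ht)
  have hym : ∀ t ∈ Set.Icc α β, y t ∈ Metric.closedBall (0 : E) (max B B') := fun t ht => by
    simpa using Or.inr (hB' t ht)
  have sub1 : Set.Icc α t₀ ⊆ Set.Icc α β := Set.Icc_subset_Icc_right ht₀.2
  have sub2 : Set.Icc t₀ β ⊆ Set.Icc α β := Set.Icc_subset_Icc_left ht₀.1
  have hl {z w : ℝ → E} (hz : ∀ t ∈ Set.Icc α β, HasDerivWithinAt z (w t) (Set.Icc α β) t) :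
      ∀ t ∈ Set.Ioc α t₀, HasDerivWithinAt z (w t) (Set.Iic t) t := fun t ht =>
    ((hz t (sub1 ⟨ht.1.le, ht.2⟩)).mono (Set.Icc_subset_Icc_right (ht.2.trans ht₀.2))
      ).mono_of_mem_nhdsWithin (Icc_mem_nhdsLE ht.1)
  have hr {z w : ℝ → E} (hz : ∀ t ∈ Set.Icc α β, HasDerivWithinAt z (w t) (Set.Icc α β) t) :
      ∀ t ∈ Set.Ico t₀ β, HasDerivWithinAt z (w t) (Set.Ici t) t := fun t ht =>
    ((hz t (sub2 ⟨ht.1, ht.2.le⟩)).mono (Set.Icc_subset_Icc_left (ht₀.1.trans ht.1))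
      ).mono_of_mem_nhdsWithin (Icc_mem_nhdsGE ht.2)
  rw [← Set.Icc_union_Icc_eq_Icc ht₀.1 ht₀.2]
  refine Set.EqOn.union ?_ ?_
  · exact ODE_solution_unique_of_mem_Icc_left (s := fun _ => Metric.closedBall 0 (max B B'))
      (fun t ht => hK t (sub1 ⟨ht.1.le, ht.2⟩)) (hxc.mono sub1) (hl hx)
      (fun t ht => hxm t (sub1 ⟨ht.1.le, ht.2⟩)) (hyc.mono sub1) (hl hy)
      (fun t ht => hym t (sub1 ⟨ht.1.le, ht.2⟩)) h0
  · exact ODE_solution_unique_of_mem_Icc_right (s := fun _ => Metric.closedBall 0 (max B B'))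
      (fun t ht => hK t (sub2 ⟨ht.1, ht.2.le⟩)) (hxc.mono sub2) (hr hx)
      (fun t ht => hxm t (sub2 ⟨ht.1, ht.2.le⟩)) (hyc.mono sub2) (hr hy)
      (fun t ht => hym t (sub2 ⟨ht.1, ht.2.le⟩)) h0

end ODE

/-! ### The probability flow on positive times -/

section Flow

variable {E : Type*} [NormedAddCommGroup E] [InnerProductSpace ℝ E] [FiniteDimensional ℝ E]
  [MeasurableSpace E] [BorelSpace E] (p0 : Measure E) [IsProbabilityMeasure p0]

lemma exists_solution_velocity {α β s : ℝ} (hα : 0 < α) (hs : s ∈ Set.Icc α β) (y : E) :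
    ∃ x : ℝ → E, x s = y ∧
      ∀ t ∈ Set.Icc α β, HasDerivWithinAt x (velocity p0 t (x t)) (Set.Icc α β) t := by
  obtain ⟨ρ, hρ0, hρ⟩ := exists_norm_velocity_le p0
  refine exists_solution_of_linear_growth (A := 3 * (1 + (1 + ρ) / α)) (by positivity)
    (exists_lipschitzOnWith_velocity p0 hα) (fun x => ?_) (fun t ht x => ?_) hs y
  · exact (continuousOn_velocity p0).comp (f := fun t : ℝ => (t, x)) (by fun_prop)
      fun t ht => ⟨hα.trans_le ht.1, trivial⟩
  · have ht0 : 0 < t := hα.trans_le ht.1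
    refine (hρ t ht0 x).trans ?_
    have h1 : (‖x‖ + ρ) / t ≤ (‖x‖ + ρ) / α := by gcongr; exact ht.1
    have h2 : (‖x‖ + ρ) / α ≤ (1 + ρ) / α * (1 + ‖x‖) := by
      rw [div_mul_eq_mul_div]
      gcongr
      nlinarith [norm_nonneg x]
    nlinarith [norm_nonneg x]

/-- A solution of the probability-flow equation on all positive times. -/
def IsFlowLine (x : ℝ → E) : Prop := ∀ t, 0 < t → HasDerivAt x (velocity p0 t (x t)) t

variable {p0}

lemma IsFlowLine.eq_of_eq {x y : ℝ → E} (hx : IsFlowLine p0 x) (hy : IsFlowLine p0 y) {s t : ℝ}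
    (hs : 0 < s) (ht : 0 < t) (h : x s = y s) : x t = y t := by
  have h0 : 0 < min s t := lt_min hs ht
  exact solution_unique_of_lipschitz_on_balls (α := min s t) (β := max s t)
    (exists_lipschitzOnWith_velocity p0 h0) ⟨min_le_left _ _, le_max_left _ _⟩
    (fun r hr => (hx r (h0.trans_le hr.1)).hasDerivWithinAt)
    (fun r hr => (hy r (h0.trans_le hr.1)).hasDerivWithinAt) h ⟨min_le_right _ _, le_max_right _ _⟩

variable (p0)

lemma exists_isFlowLine {s : ℝ} (hs : 0 < s) (y : E) :
    ∃ x : ℝ → E, x s = y ∧ IsFlowLine p0 x := by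
  have hex : ∀ t : ℝ, ∃ x : ℝ → E, 0 < t → x s = y ∧
      ∀ r ∈ Set.Icc (min s t / 2) (max s t + 1), HasDerivWithinAt x (velocity p0 r (x r))
        (Set.Icc (min s t / 2) (max s t + 1)) r := by
    intro t
    by_cases ht : 0 < t
    · have h0 : 0 < min s t := lt_min hs ht
      have hsm : s ∈ Set.Icc (min s t / 2) (max s t + 1) :=
        ⟨by linarith [min_le_left s t], by linarith [le_max_left s t]⟩
      obtain ⟨x, hx⟩ := exists_solution_velocity p0 (by positivity) hsm y
      exact ⟨x, fun _ => hx⟩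
    · exact ⟨0, fun h => absurd h ht⟩
  choose X hX using hex
  -- the local solutions agree where they are all defined, so they glue along the diagonal
  refine ⟨fun t => X t t, (hX s hs).1, fun t ht => ?_⟩
  have h0 : 0 < min s t := lt_min hs ht
  have htm : t ∈ Set.Ioo (min s t / 2) (max s t + 1) :=
    ⟨by linarith [min_le_right s t], by linarith [le_max_right s t]⟩
  have heq : (fun r => X r r) =ᶠ[𝓝 t] X t := by
    filter_upwards [Ioo_mem_nhds htm.1 htm.2] with r hr
    have hr0 : 0 < r := by linarith [hr.1]
    have hr1 : 0 < min s r := lt_min hs hr0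
    have hlo : 0 < max (min s t / 2) (min s r / 2) := lt_max_of_lt_left (by positivity)
    set α := max (min s t / 2) (min s r / 2)
    set β := min (max s t + 1) (max s r + 1)
    have sub1 : Set.Icc α β ⊆ Set.Icc (min s t / 2) (max s t + 1) :=
      Set.Icc_subset_Icc (le_max_left _ _) (min_le_left _ _)
    have sub2 : Set.Icc α β ⊆ Set.Icc (min s r / 2) (max s r + 1) :=
      Set.Icc_subset_Icc (le_max_right _ _) (min_le_right _ _)
    have hsm : s ∈ Set.Icc α β := by
      refine ⟨max_le ?_ ?_, le_min ?_ ?_⟩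
      · linarith [min_le_left s t]
      · linarith [min_le_left s r]
      · linarith [le_max_left s t]
      · linarith [le_max_left s r]
    have hrm : r ∈ Set.Icc α β := by
      refine ⟨max_le hr.1.le ?_, le_min hr.2.le ?_⟩
      · linarith [min_le_right s r]
      · linarith [le_max_right s r]
    exact solution_unique_of_lipschitz_on_balls (exists_lipschitzOnWith_velocity p0 hlo) hsm
      (fun q hq => ((hX r hr0).2 q (sub2 hq)).mono sub2)
      (fun q hq => ((hX t ht).2 q (sub1 hq)).mono sub1)
      ((hX r hr0).1.trans (hX t ht).1.symm) hrm
  have hd := ((hX t ht).2 t ⟨htm.1.le, htm.2.le⟩).hasDerivAt (Icc_mem_nhds htm.1 htm.2)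
  exact hd.congr_of_eventuallyEq heq

open Classical in
/-- The position at time `t` of the solution of the probability-flow equation that is at `y` at
time `s`, for positive times `s` and `t`. For `s ≤ 0` it is the constant `y`. -/
noncomputable def flow (s t : ℝ) (y : E) : E :=
  if hs : 0 < s then (exists_isFlowLine p0 hs y).choose t else y

variable {p0} in
lemma isFlowLine_flow {s : ℝ} (hs : 0 < s) (y : E) : IsFlowLine p0 (fun t => flow p0 s t y) := by
  simp only [flow, hs, dif_pos]
  exact (exists_isFlowLine p0 hs y).choose_spec.2

lemma flow_self {s : ℝ} (hs : 0 < s) (y : E) : flow p0 s s y = y := by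
  simp only [flow, hs, dif_pos]
  exact (exists_isFlowLine p0 hs y).choose_spec.1

lemma flow_trans {s r t : ℝ} (hs : 0 < s) (hr : 0 < r) (ht : 0 < t) (y : E) :
    flow p0 r t (flow p0 s r y) = flow p0 s t y :=
  (isFlowLine_flow hr _).eq_of_eq (isFlowLine_flow hs y) hr ht (flow_self p0 hr _)

lemma flow_flow_cancel {s t : ℝ} (hs : 0 < s) (ht : 0 < t) (y : E) :
    flow p0 t s (flow p0 s t y) = y := by
  rw [flow_trans p0 hs ht hs, flow_self p0 hs]

lemma continuousOn_flow {s : ℝ} (hs : 0 < s) (y : E) :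
    ContinuousOn (fun t => flow p0 s t y) (Set.Ioi 0) :=
  fun t ht => (isFlowLine_flow hs y t ht).continuousAt.continuousWithinAt

/-- Forwards in time the flow expands distances at most by the ratio of the times. -/
lemma norm_flow_sub_le {s t : ℝ} (hs : 0 < s) (hst : s ≤ t) (y z : E) :
    ‖flow p0 s t y - flow p0 s t z‖ ≤ t / s * ‖y - z‖ := by
  set δ : ℝ → E := fun r => flow p0 s r y - flow p0 s r z with hδ
  have hd : ∀ r, 0 < r → HasDerivAt (fun r => ‖r⁻¹ • δ r‖ ^ 2)
      (2 * inner ℝ (r⁻¹ • δ r) (r⁻¹ • (velocity p0 r (flow p0 s r y) -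
        velocity p0 r (flow p0 s r z)) + (-(r ^ 2)⁻¹) • δ r)) r := fun r hr =>
    ((hasDerivAt_inv hr.ne').smul
      ((isFlowLine_flow hs y r hr).sub (isFlowLine_flow hs z r hr))).norm_sq
  have hanti : AntitoneOn (fun r => ‖r⁻¹ • δ r‖ ^ 2) (Set.Icc s t) := by
    refine antitoneOn_of_deriv_nonpos (convex_Icc s t)
      (fun r hr => (hd r (hs.trans_le hr.1)).continuousAt.continuousWithinAt)
      (fun r hr => ?_) fun r hr => ?_
    · rw [interior_Icc] at hr
      exact (hd r (hs.trans hr.1)).differentiableAt.differentiableWithinAt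
    · rw [interior_Icc] at hr
      have hr0 : 0 < r := hs.trans hr.1
      rw [(hd r hr0).deriv]
      have h := inner_velocity_sub_le p0 hr0 (flow p0 s r y) (flow p0 s r z)
      have e : inner ℝ (r⁻¹ • δ r) (r⁻¹ • (velocity p0 r (flow p0 s r y) -
          velocity p0 r (flow p0 s r z)) + (-(r ^ 2)⁻¹) • δ r) = (r ^ 2)⁻¹ *
          (inner ℝ (velocity p0 r (flow p0 s r y) - velocity p0 r (flow p0 s r z)) (δ r) -
            r⁻¹ * ‖δ r‖ ^ 2) := by
        rw [real_inner_smul_left, inner_add_right, real_inner_smul_right, real_inner_smul_right,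
          real_inner_self_eq_norm_sq, real_inner_comm]
        ring
      rw [e]
      have : (r ^ 2)⁻¹ * (inner ℝ (velocity p0 r (flow p0 s r y) -
          velocity p0 r (flow p0 s r z)) (δ r) - r⁻¹ * ‖δ r‖ ^ 2) ≤ 0 :=
        mul_nonpos_of_nonneg_of_nonpos (by positivity) (by linarith)
      linarith
  have h := hanti (Set.left_mem_Icc.2 hst) (Set.right_mem_Icc.2 hst) hst
  have ht : 0 < t := hs.trans_le hst
  have h2 := abs_le_of_sq_le_sq h (norm_nonneg _)
  rw [abs_of_nonneg (norm_nonneg _), norm_smul, norm_smul, Real.norm_of_nonneg (by positivity),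
    Real.norm_of_nonneg (by positivity)] at h2
  have e : δ s = y - z := by simp [hδ, flow_self p0 hs]
  rw [e, inv_mul_le_iff₀ ht] at h2
  calc _ ≤ _ := h2
    _ = _ := by ring

lemma lipschitzWith_flow {s t : ℝ} (hs : 0 < s) (hst : s ≤ t) :
    LipschitzWith (t / s).toNNReal (flow p0 s t) :=
  LipschitzWith.of_dist_le_mul fun y z => by
    have : 0 ≤ t / s := div_nonneg (hs.le.trans hst) hs.le
    rw [Real.coe_toNNReal _ this, dist_eq_norm, dist_eq_norm]
    exact norm_flow_sub_le p0 hs hst y z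

lemma flow_injective {s t : ℝ} (hs : 0 < s) (ht : 0 < t) : Function.Injective (flow p0 s t) :=
  Function.LeftInverse.injective (flow_flow_cancel p0 hs ht)

/-- The flow is measurable: forwards in time it is continuous, and backwards it is the inverse of
an injective continuous map. -/
lemma measurable_flow {s t : ℝ} (hs : 0 < s) (ht : 0 < t) : Measurable (flow p0 s t) := by
  rcases le_total s t with h | h
  · exact (lipschitzWith_flow p0 hs h).continuous.measurable
  · have hm : MeasurableEmbedding (flow p0 t s) :=
      (lipschitzWith_flow p0 ht h).continuous.measurableEmbedding (flow_injective p0 ht hs)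
    intro A hA
    have : flow p0 s t ⁻¹' A = flow p0 t s '' A :=
      congrFun (Set.image_eq_preimage_of_inverse (flow_flow_cancel p0 ht hs)
        (flow_flow_cancel p0 hs ht)).symm A
    rw [this]
    exact hm.measurableSet_image.2 hA

lemma measurableEmbedding_flow {s t : ℝ} (hs : 0 < s) (ht : 0 < t) :
    MeasurableEmbedding (flow p0 s t) :=
  (measurable_flow p0 hs ht).measurableEmbedding (flow_injective p0 hs ht)

end Flow

/-! ### The standard Gaussian measure: density and second moment -/

section Gaussian

variable {E : Type*} [NormedAddCommGroup E] [InnerProductSpace ℝ E] [FiniteDimensional ℝ E]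
  [MeasurableSpace E] [BorelSpace E]

/-- The standard Gaussian has density proportional to `bump`; the value of the constant is never
needed. -/
lemma exists_stdGaussian_eq_withDensity :
    ∃ c : ℝ, 0 < c ∧ stdGaussian E =
      (volume : Measure E).withDensity (fun x => ENNReal.ofReal (c * bump x)) := by
  set d := (Real.pi / (1 / 2 : ℝ)) ^ (Module.finrank ℝ E / 2 : ℝ) with hd
  have hd0 : 0 < d := by positivity
  have hint : ∫ x : E, bump x = d := by
    rw [hd, ← GaussianFourier.integral_rexp_neg_mul_sq_norm (V := E) (by norm_num : (0:ℝ) < 1 / 2)]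
    congr with x
    unfold bump
    ring_nf
  have hi : Integrable (bump : E → ℝ) := by
    by_contra h
    rw [integral_undef h] at hint
    exact hd0.ne hint
  have hic : Integrable (fun x : E => d⁻¹ * bump x) := hi.const_mul _
  have hnn : ∀ x : E, 0 ≤ d⁻¹ * bump x := fun x => mul_nonneg (by positivity) (bump_pos x).le
  refine ⟨d⁻¹, by positivity, ?_⟩
  have : IsFiniteMeasure ((volume : Measure E).withDensity
      (fun x => ENNReal.ofReal (d⁻¹ * bump x))) :=
    isFiniteMeasure_withDensity_ofReal hic.2
  refine Measure.ext_of_charFun ?_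
  ext t
  rw [charFun_stdGaussian, charFun_apply, integral_withDensity_eq_integral_toReal_smul
    (by fun_prop) (ae_of_all _ fun _ => ENNReal.ofReal_lt_top)]
  have h := GaussianFourier.integral_cexp_neg_mul_sq_norm_add (V := E) (b := (1 / 2 : ℂ))
    (by norm_num) Complex.I t
  have h0 : ((Real.pi : ℂ) / (1 / 2 : ℂ)) ^ (Module.finrank ℝ E / 2 : ℂ) = (d : ℂ) := by
    rw [hd, Complex.ofReal_cpow (by positivity)]
    push_cast
    rfl
  rw [h0] at h
  have e : ∀ x : E, (ENNReal.ofReal (d⁻¹ * bump x)).toReal •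
      Complex.exp ((inner ℝ x t : ℝ) * Complex.I) =
      (d : ℂ)⁻¹ * Complex.exp (-(1 / 2 : ℂ) * (‖x‖ : ℂ) ^ 2 + Complex.I * (inner ℝ t x : ℝ)) := by
    intro x
    rw [ENNReal.toReal_ofReal (hnn x), Complex.real_smul, Complex.exp_add, bump, real_inner_comm]
    push_cast
    rw [mul_assoc]
    congr 3 <;> ring_nf
  simp_rw [e]
  rw [integral_const_mul, h, ← mul_assoc, inv_mul_cancel₀ (by exact_mod_cast hd0.ne'), one_mul,
    Complex.I_sq]
  congr 1
  ring

lemma lintegral_sq_norm_stdGaussian :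
    ∫⁻ z, ENNReal.ofReal (‖z‖ ^ 2) ∂(stdGaussian E) = Module.finrank ℝ E := by
  have hL (L : StrongDual ℝ E) : ∫ z, L z ^ 2 ∂(stdGaussian E) = ‖L‖ ^ 2 := by
    rw [← variance_dual_stdGaussian, variance_of_integral_eq_zero (by fun_prop) (by simp)]
  have hi (L : StrongDual ℝ E) : Integrable (fun z => L z ^ 2) (stdGaussian E) :=
    (IsGaussian.memLp_dual (stdGaussian E) L 2 (by simp)).integrable_sq
  set b := stdOrthonormalBasis ℝ E
  have e : ∀ z : E, ‖z‖ ^ 2 = ∑ i, (innerSL ℝ (b i)) z ^ 2 := fun z => by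
    simpa using (b.sum_sq_inner_right z).symm
  have hint : Integrable (fun z : E => ‖z‖ ^ 2) (stdGaussian E) := by
    simp_rw [e]
    exact integrable_finsetSum _ fun i _ => hi _
  rw [← ofReal_integral_eq_lintegral_ofReal hint (ae_of_all _ fun z => by positivity)]
  simp_rw [e]
  rw [integral_finsetSum _ fun i _ => hi _]
  simp_rw [hL, innerSL_apply_norm, b.norm_eq_one]
  simp

lemma lintegral_norm_stdGaussian_le :
    ∫⁻ z, ENNReal.ofReal ‖z‖ ∂(stdGaussian E) ≤ ENNReal.ofReal √(Module.finrank ℝ E) := by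
  have hp : MemLp id 2 (stdGaussian E) := IsGaussian.memLp_two_id
  have h2 : Integrable (fun z : E => ‖z‖ ^ 2) (stdGaussian E) := hp.norm.integrable_sq
  have h1 : Integrable (fun z : E => ‖z‖) (stdGaussian E) := (hp.integrable (by norm_num)).norm
  rw [← ofReal_integral_eq_lintegral_ofReal h1 (ae_of_all _ fun z => norm_nonneg _)]
  refine ENNReal.ofReal_le_ofReal (Real.le_sqrt_of_sq_le ?_)
  have h3 : ∫ z : E, ‖z‖ ^ 2 ∂(stdGaussian E) = Module.finrank ℝ E := by
    have := lintegral_sq_norm_stdGaussian (E := E)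
    rw [← ofReal_integral_eq_lintegral_ofReal h2 (ae_of_all _ fun z => by positivity)] at this
    have h := congrArg ENNReal.toReal this
    rwa [ENNReal.toReal_ofReal (integral_nonneg fun z => by positivity), ENNReal.toReal_natCast]
      at h
  have h4 := variance_nonneg (fun z : E => ‖z‖) (stdGaussian E)
  have hp' : MemLp (fun z : E => ‖z‖) 2 (stdGaussian E) := hp.norm
  rw [variance_eq_sub hp'] at h4
  simp only [Pi.pow_apply] at h4
  linarith

end Gaussian

/-! ### The noised data and the posterior of the data point -/

section Posterior

variable {E : Type*} [NormedAddCommGroup E] [InnerProductSpace ℝ E] [FiniteDimensional ℝ E]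
  [MeasurableSpace E] [BorelSpace E] (p0 : Measure E) [IsProbabilityMeasure p0]

/-- The law of `a + t z` for independent `a ∼ p0` and `z ∼ N(0, I)`. -/
noncomputable def noised (t : ℝ) : Measure E :=
  (p0.prod (stdGaussian E)).map (fun w => w.1 + t • w.2)

instance isProbabilityMeasure_noised (t : ℝ) : IsProbabilityMeasure (noised p0 t) :=
  Measure.isProbabilityMeasure_map (by fun_prop)

lemma smoothed_eq_noised {n : ℕ} (p0 : Measure (EuclideanSpace ℝ (Fin n)))
    [IsProbabilityMeasure p0] (t : ℝ) : smoothed p0 t = noised p0 t := by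
  rw [smoothed, noised, Measure.conv]
  have : p0.prod ((stdGaussian (EuclideanSpace ℝ (Fin n))).map (fun z => t • z)) =
      (p0.prod (stdGaussian (EuclideanSpace ℝ (Fin n)))).map (Prod.map id (fun z => t • z)) := by
    have := Measure.map_prod_map p0 (stdGaussian (EuclideanSpace ℝ (Fin n))) measurable_id
      (measurable_const_smul t)
    rwa [Measure.map_id] at this
  rw [this, Measure.map_map (by fun_prop) (by fun_prop)]
  rfl

lemma noised_zero : noised p0 0 = p0 := by
  simp only [noised, zero_smul, add_zero]
  exact Measure.fst_prod

/-- The conditional law of `a` given `a + t z = x`. -/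
noncomputable def posterior (t : ℝ) : Kernel E E :=
  Kernel.withDensity (Kernel.const E p0)
    (fun x a => ENNReal.ofReal (bump (noise t x a) / partitionFn p0 t x))

@[fun_prop]
lemma measurable_partitionFn (t : ℝ) : Measurable (partitionFn p0 t) := by
  unfold partitionFn noise
  exact (StronglyMeasurable.integral_prod_right'
    (f := fun p : E × E => bump (t⁻¹ • (p.1 - p.2)))
    (Measurable.stronglyMeasurable (by fun_prop))).measurable

@[fun_prop]
lemma measurable_noiseMoment (t : ℝ) : Measurable (noiseMoment p0 t) := by
  unfold noiseMoment noise
  exact (StronglyMeasurable.integral_prod_right'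
    (f := fun p : E × E => bump (t⁻¹ • (p.1 - p.2)) • (t⁻¹ • (p.1 - p.2)))
    (Measurable.stronglyMeasurable (by fun_prop))).measurable

@[fun_prop]
lemma measurable_velocity (t : ℝ) : Measurable (velocity p0 t) := by
  unfold velocity
  fun_prop

lemma measurable_posterior_density (t : ℝ) : Measurable (Function.uncurry fun x a : E =>
    ENNReal.ofReal (bump (noise t x a) / partitionFn p0 t x)) := by
  unfold noise
  fun_prop

lemma lintegral_posterior (t : ℝ) (x : E) {F : E → ℝ≥0∞} (hF : Measurable F) :
    ∫⁻ a, F a ∂(posterior p0 t x) = (ENNReal.ofReal (partitionFn p0 t x))⁻¹ *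
      ∫⁻ a, ENNReal.ofReal (bump (noise t x a)) * F a ∂p0 := by
  rw [posterior, Kernel.lintegral_withDensity _ (measurable_posterior_density p0 t) _ hF,
    Kernel.const_apply, ← lintegral_const_mul _ (by fun_prop)]
  congr with a
  rw [ENNReal.ofReal_div_of_pos (partitionFn_pos p0 t x), ENNReal.div_eq_inv_mul, mul_assoc]

lemma posterior_apply (t : ℝ) (x : E) : posterior p0 t x =
    p0.withDensity fun a => ENNReal.ofReal (bump (noise t x a) / partitionFn p0 t x) := by
  rw [posterior, Kernel.withDensity_apply _ (measurable_posterior_density p0 t),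
    Kernel.const_apply]

instance isMarkovKernel_posterior (t : ℝ) : IsMarkovKernel (posterior p0 t) := by
  refine ⟨fun x => ⟨?_⟩⟩
  have h := lintegral_posterior p0 t x (F := fun _ => 1) measurable_const
  rw [lintegral_one] at h
  simp only [mul_one] at h
  rw [h, ← ofReal_integral_eq_lintegral_ofReal (integrable_bump_noise p0 t x)
    (ae_of_all _ fun a => (bump_pos _).le)]
  exact ENNReal.inv_mul_cancel (by simpa using partitionFn_pos p0 t x) ENNReal.ofReal_ne_top

lemma integral_posterior {F : Type*} [NormedAddCommGroup F] [NormedSpace ℝ F] (t : ℝ) (x : E)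
    (f : E → F) : ∫ a, f a ∂(posterior p0 t x) =
      (partitionFn p0 t x)⁻¹ • ∫ a, bump (noise t x a) • f a ∂p0 := by
  rw [posterior_apply, integral_withDensity_eq_integral_toReal_smul (by fun_prop)
    (ae_of_all _ fun _ => ENNReal.ofReal_lt_top), ← integral_smul]
  congr with a
  rw [ENNReal.toReal_ofReal (div_nonneg (bump_pos _).le (partitionFn_pos p0 t x).le), smul_smul,
    div_eq_inv_mul]

lemma integrable_posterior_iff {F : Type*} [NormedAddCommGroup F] [NormedSpace ℝ F] (t : ℝ) (x : E)
    (f : E → F) : Integrable f (posterior p0 t x) ↔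
      Integrable (fun a => bump (noise t x a) • f a) p0 := by
  rw [posterior_apply, integrable_withDensity_iff_integrable_smul' (by fun_prop)
    (ae_of_all _ fun _ => ENNReal.ofReal_lt_top)]
  have hZ := partitionFn_pos p0 t x
  rw [← integrable_smul_iff (inv_ne_zero hZ.ne') (fun a => bump (noise t x a) • f a)]
  refine integrable_congr (ae_of_all _ fun a => ?_)
  simp only [Pi.smul_apply]
  rw [ENNReal.toReal_ofReal (div_nonneg (bump_pos _).le hZ.le), smul_smul, div_eq_inv_mul]

lemma integral_noise_posterior (t : ℝ) (x : E) :
    ∫ a, noise t x a ∂(posterior p0 t x) = velocity p0 t x := by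
  rw [integral_posterior]
  rfl

lemma integrable_noise_posterior (t : ℝ) (x : E) :
    Integrable (noise t x) (posterior p0 t x) :=
  (integrable_posterior_iff p0 t x _).2 (integrable_bump_smul_noise p0 t x)

lemma integrable_sq_noise_posterior (t : ℝ) (x : E) :
    Integrable (fun a => ‖noise t x a‖ ^ 2) (posterior p0 t x) := by
  refine (integrable_posterior_iff p0 t x _).2
    (Integrable.of_bound (C := 2) (by fun_prop) (ae_of_all _ fun a => ?_))
  rw [smul_eq_mul, Real.norm_of_nonneg (mul_nonneg (bump_pos _).le (by positivity))]
  have := bump_mul_one_add_sq_le (noise t x a)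
  have := bump_pos (noise t x a)
  nlinarith

/-- The posterior second moment of the noise. -/
noncomputable def noiseSq (t : ℝ) (x : E) : ℝ := ∫ a, ‖noise t x a‖ ^ 2 ∂(posterior p0 t x)

lemma noiseSq_nonneg (t : ℝ) (x : E) : 0 ≤ noiseSq p0 t x :=
  integral_nonneg fun _ => by positivity

lemma integral_norm_add_smul_noise (t h : ℝ) (x w : E) :
    ∫ a, ‖w + h • noise t x a‖ ^ 2 ∂(posterior p0 t x) =
      ‖w‖ ^ 2 + 2 * h * inner ℝ w (velocity p0 t x) + h ^ 2 * noiseSq p0 t x := by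
  have e : ∀ a, ‖w + h • noise t x a‖ ^ 2 =
      ‖w‖ ^ 2 + 2 * h * inner ℝ w (noise t x a) + h ^ 2 * ‖noise t x a‖ ^ 2 := by
    intro a
    rw [norm_add_sq_real, real_inner_smul_right, norm_smul, mul_pow, Real.norm_eq_abs, sq_abs]
    ring
  simp_rw [e]
  have h1 : Integrable (fun a => 2 * h * inner ℝ w (noise t x a)) (posterior p0 t x) :=
    ((integrable_noise_posterior p0 t x).const_inner w).const_mul _
  have h2 := (integrable_sq_noise_posterior p0 t x).const_mul (h ^ 2)
  have e1 := integral_add ((integrable_const (‖w‖ ^ 2)).add h1) h2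
  have e2 := integral_add (integrable_const (‖w‖ ^ 2)) h1
  simp only [Pi.add_apply] at e1
  rw [e1, e2, integral_const_mul, integral_const_mul,
    integral_inner (integrable_noise_posterior p0 t x), integral_noise_posterior]
  simp [noiseSq]

lemma integrable_norm_add_smul_noise (t h : ℝ) (x w : E) :
    Integrable (fun a => ‖w + h • noise t x a‖ ^ 2) (posterior p0 t x) := by
  have e : (fun a => ‖w + h • noise t x a‖ ^ 2) = fun a =>
      ‖w‖ ^ 2 + 2 * h * inner ℝ w (noise t x a) + h ^ 2 * ‖noise t x a‖ ^ 2 := by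
    funext a
    rw [norm_add_sq_real, real_inner_smul_right, norm_smul, mul_pow, Real.norm_eq_abs, sq_abs]
    ring
  rw [e]
  exact ((integrable_const _).add
    (((integrable_noise_posterior p0 t x).const_inner w).const_mul _)).add
    ((integrable_sq_noise_posterior p0 t x).const_mul (h ^ 2))

lemma sq_norm_velocity_le (t : ℝ) (x : E) : ‖velocity p0 t x‖ ^ 2 ≤ noiseSq p0 t x := by
  have h := integral_norm_add_smul_noise p0 t (-1) x (velocity p0 t x)
  have h0 : 0 ≤ ∫ a, ‖velocity p0 t x + (-1 : ℝ) • noise t x a‖ ^ 2 ∂(posterior p0 t x) :=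
    integral_nonneg fun _ => by positivity
  rw [h, real_inner_self_eq_norm_sq] at h0
  linarith

/-- One step along the posterior noise moves a point, in mean square, like a step along the
velocity, up to a variance term of second order in the step size. -/
lemma integral_norm_add_smul_noise_le (t h : ℝ) (x w : E) :
    ∫ a, ‖w + h • noise t x a‖ ^ 2 ∂(posterior p0 t x) ≤
      ‖w + h • velocity p0 t x‖ ^ 2 + h ^ 2 * noiseSq p0 t x := by
  rw [integral_norm_add_smul_noise, norm_add_sq_real, real_inner_smul_right]
  have : 0 ≤ ‖h • velocity p0 t x‖ ^ 2 := by positivity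
  linarith

/-- Integration against the Gaussian after a translation and a dilation, in terms of `bump`. -/
lemma exists_lintegral_stdGaussian_eq {t : ℝ} (ht : 0 < t) :
    ∃ K : ℝ≥0∞, ∀ (a : E) (F : E → ℝ≥0∞), Measurable F →
      ∫⁻ z, F (a + t • z) ∂(stdGaussian E) =
        K * ∫⁻ x, ENNReal.ofReal (bump (noise t x a)) * F x := by
  obtain ⟨c, hc, hG⟩ := exists_stdGaussian_eq_withDensity (E := E)
  refine ⟨ENNReal.ofReal c * ENNReal.ofReal |(t ^ Module.finrank ℝ E)⁻¹|, fun a F hF => ?_⟩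
  have hm : Measurable fun x => ENNReal.ofReal (bump (noise t x a)) * F x := by
    unfold noise
    fun_prop
  have hm' : Measurable fun x => ENNReal.ofReal (bump (noise t (a + x) a)) * F (a + x) := by
    unfold noise
    fun_prop
  rw [hG, lintegral_withDensity_eq_lintegral_mul _ (by fun_prop) (by fun_prop),
    ← lintegral_add_left_eq_self (fun x => ENNReal.ofReal (bump (noise t x a)) * F x) a,
    mul_assoc, ← smul_eq_mul (a := ENNReal.ofReal |_|), ← lintegral_smul_measure,
    ← Measure.map_addHaar_smul volume ht.ne', lintegral_map hm' (by fun_prop),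
    ← lintegral_const_mul _ (f := fun z => ENNReal.ofReal (bump (noise t (a + t • z) a)) *
      F (a + t • z)) (hm'.comp (measurable_const_smul t))]
  congr with z
  have : noise t (a + t • z) a = z := by
    rw [noise, add_sub_cancel_left, smul_smul, inv_mul_cancel₀ ht.ne', one_smul]
  simp only [Pi.mul_apply, this]
  rw [ENNReal.ofReal_mul hc.le, mul_assoc]

/-- Bayes' formula: drawing `a + t z` and then `a` from the posterior reproduces the joint law. -/
theorem noised_compProd_posterior {t : ℝ} (ht : 0 < t) :
    noised p0 t ⊗ₘ posterior p0 t =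
      (p0.prod (stdGaussian E)).map (fun w => (w.1 + t • w.2, w.1)) := by
  obtain ⟨K, hK⟩ := exists_lintegral_stdGaussian_eq (E := E) ht
  -- both sides are computed in terms of Lebesgue measure by Tonelli's theorem
  have key : ∀ F : E × E → ℝ≥0∞, Measurable F →
      ∫⁻ w, F (w.1 + t • w.2, w.1) ∂(p0.prod (stdGaussian E)) =
        K * ∫⁻ x, ∫⁻ a, ENNReal.ofReal (bump (noise t x a)) * F (x, a) ∂p0 := by
    intro F hF
    have hb : Measurable fun p : E × E =>
        ENNReal.ofReal (bump (noise t p.1 p.2)) * F (p.1, p.2) := by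
      unfold noise
      fun_prop
    have hb' : Measurable fun a => ∫⁻ x, ENNReal.ofReal (bump (noise t x a)) * F (x, a) :=
      Measurable.lintegral_prod_left' hb
    rw [lintegral_prod _ (by fun_prop), lintegral_lintegral_swap (μ := volume) (ν := p0)
      (f := fun x a => ENNReal.ofReal (bump (noise t x a)) * F (x, a)) hb.aemeasurable,
      ← lintegral_const_mul _ hb']
    congr with a
    exact hK a (fun x => F (x, a)) (by fun_prop)
  refine Measure.ext_of_lintegral _ fun F hF => ?_
  rw [Measure.lintegral_compProd hF, lintegral_map hF (by fun_prop), key F hF, noised,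
    lintegral_map (hF.lintegral_kernel_prod_right') (by fun_prop)]
  have hP : Measurable fun x => ∫⁻ a, F (x, a) ∂(posterior p0 t x) :=
    hF.lintegral_kernel_prod_right'
  rw [key (fun p => ∫⁻ a, F (p.1, a) ∂(posterior p0 t p.1)) (hP.comp measurable_fst)]
  congr 1
  refine lintegral_congr fun x => ?_
  have hZ := partitionFn_pos p0 t x
  have hF' : Measurable fun a => F (x, a) := by fun_prop
  change ∫⁻ a, ENNReal.ofReal (bump (noise t x a)) * ∫⁻ b, F (x, b) ∂(posterior p0 t x) ∂p0 = _
  rw [lintegral_mul_const _ (by fun_prop), lintegral_posterior p0 t x hF',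
    ← ofReal_integral_eq_lintegral_ofReal (integrable_bump_noise p0 t x)
      (ae_of_all _ fun a => (bump_pos _).le), ← mul_assoc]
  change ENNReal.ofReal (partitionFn p0 t x) * _ * _ = _
  rw [ENNReal.mul_inv_cancel (by simpa using hZ) ENNReal.ofReal_ne_top, one_mul]

/-- Averaged over `x ∼ p_t`, the posterior second moment of the noise is that of `N(0, I)`. -/
lemma lintegral_noiseSq {t : ℝ} (ht : 0 < t) :
    ∫⁻ x, ENNReal.ofReal (noiseSq p0 t x) ∂(noised p0 t) = Module.finrank ℝ E := by
  have hm : Measurable fun p : E × E => ENNReal.ofReal (‖noise t p.1 p.2‖ ^ 2) := by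
    unfold noise
    fun_prop
  have h1 : ∀ x, ENNReal.ofReal (noiseSq p0 t x) =
      ∫⁻ a, ENNReal.ofReal (‖noise t x a‖ ^ 2) ∂(posterior p0 t x) := fun x =>
    ofReal_integral_eq_lintegral_ofReal (integrable_sq_noise_posterior p0 t x)
      (ae_of_all _ fun _ => by positivity)
  simp_rw [h1]
  rw [← Measure.lintegral_compProd hm, noised_compProd_posterior p0 ht,
    lintegral_map hm (by fun_prop), ← lintegral_sq_norm_stdGaussian]
  have : ∀ w : E × E, noise t (w.1 + t • w.2) w.1 = w.2 := fun w => by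
    rw [noise, add_sub_cancel_left, smul_smul, inv_mul_cancel₀ ht.ne', one_smul]
  simp_rw [this]
  rw [lintegral_prod _ (by fun_prop)]
  simp

/-- The mean speed of the probability flow is bounded uniformly in time, whatever the moments of
`p0`. -/
lemma lintegral_norm_velocity_le {t : ℝ} (ht : 0 < t) :
    ∫⁻ x, ENNReal.ofReal ‖velocity p0 t x‖ ∂(noised p0 t) ≤ 1 + Module.finrank ℝ E := by
  rw [← lintegral_noiseSq p0 ht]
  calc _ ≤ ∫⁻ x, (1 + ENNReal.ofReal (noiseSq p0 t x)) ∂(noised p0 t) := by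
        refine lintegral_mono fun x => ?_
        have h := sq_norm_velocity_le p0 t x
        rw [← ENNReal.ofReal_one, ← ENNReal.ofReal_add zero_le_one (noiseSq_nonneg p0 t x)]
        refine ENNReal.ofReal_le_ofReal ?_
        nlinarith [sq_nonneg (‖velocity p0 t x‖ - 1)]
    _ = _ := by rw [lintegral_add_left measurable_const]; simp

end Posterior

/-! ### The flow transports the noised data -/

section Transport

variable {E : Type*} [NormedAddCommGroup E] [InnerProductSpace ℝ E] [FiniteDimensional ℝ E]
  [MeasurableSpace E] [BorelSpace E] (p0 : Measure E) [IsProbabilityMeasure p0]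

/-- The mean square distance of `X` to the flow line started at `Y` at time `s₀`, read off at
time `t`, for `(X, Y) ∼ γ` and on the event `‖Y‖ ≤ ρ`. -/
noncomputable def trackingError (s₀ ρ t : ℝ) (γ : Measure (E × E)) : ℝ≥0∞ :=
  ∫⁻ w, (Metric.closedBall (0 : E) ρ).indicator
    (fun y => ENNReal.ofReal (‖w.1 - flow p0 s₀ t y‖ ^ 2)) w.2 ∂γ

lemma measurable_trackingError_integrand {s₀ ρ t : ℝ} (hs₀ : 0 < s₀) (ht : 0 < t) :
    Measurable fun w : E × E => (Metric.closedBall (0 : E) ρ).indicator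
      (fun y => ENNReal.ofReal (‖w.1 - flow p0 s₀ t y‖ ^ 2)) w.2 := by
  have hf := measurable_flow p0 hs₀ ht
  have : (fun w : E × E => (Metric.closedBall (0 : E) ρ).indicator
      (fun y => ENNReal.ofReal (‖w.1 - flow p0 s₀ t y‖ ^ 2)) w.2) =
      (Prod.snd ⁻¹' Metric.closedBall (0 : E) ρ).indicator
        (fun w : E × E => ENNReal.ofReal (‖w.1 - flow p0 s₀ t w.2‖ ^ 2)) := rfl
  rw [this]
  refine Measurable.indicator ?_ (measurable_snd Metric.isClosed_closedBall.measurableSet)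
  have hf2 : Measurable fun w : E × E => flow p0 s₀ t w.2 := hf.comp measurable_snd
  fun_prop

/-- One step of size `h` along the posterior noise, with `Y` kept. -/
noncomputable def posteriorStep (s h : ℝ) (γ : Measure (E × E)) : Measure (E × E) :=
  (γ ⊗ₘ (posterior p0 s).comap Prod.fst measurable_fst).map
    (fun p => (p.1.1 + h • noise s p.1.1 p.2, p.1.2))

lemma lintegral_posteriorStep (s h : ℝ) (γ : Measure (E × E)) [SFinite γ] {F : E × E → ℝ≥0∞}
    (hF : Measurable F) : ∫⁻ w, F w ∂(posteriorStep p0 s h γ) =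
      ∫⁻ w, ∫⁻ a, F (w.1 + h • noise s w.1 a, w.2) ∂(posterior p0 s w.1) ∂γ := by
  have hm : Measurable fun p : (E × E) × E => (p.1.1 + h • noise s p.1.1 p.2, p.1.2) := by
    unfold noise
    fun_prop
  have hFm : Measurable fun p : (E × E) × E => F (p.1.1 + h • noise s p.1.1 p.2, p.1.2) :=
    hF.comp hm
  rw [posteriorStep, lintegral_map hF hm, Measure.lintegral_compProd hFm]
  simp only [Kernel.comap_apply]

lemma map_snd_posteriorStep (s h : ℝ) (γ : Measure (E × E)) [SFinite γ] :
    (posteriorStep p0 s h γ).map Prod.snd = γ.map Prod.snd := by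
  refine Measure.ext_of_lintegral _ fun F hF => ?_
  rw [lintegral_map hF measurable_snd, lintegral_map hF measurable_snd,
    lintegral_posteriorStep p0 s h γ (F := fun w => F w.2) (hF.comp measurable_snd)]
  simp

/-- The step is exact for the marginal law: it leads from `p_s` to `p_{s+h}`. -/
lemma map_fst_posteriorStep {s : ℝ} (hs : 0 < s) (h : ℝ) (γ : Measure (E × E)) [SFinite γ]
    (hγ : γ.map Prod.fst = noised p0 s) :
    (posteriorStep p0 s h γ).map Prod.fst = noised p0 (s + h) := by
  refine Measure.ext_of_lintegral _ fun F hF => ?_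
  have hm : Measurable fun q : E × E => F (q.1 + h • noise s q.1 q.2) := by
    unfold noise
    fun_prop
  have hm' : Measurable fun x => ∫⁻ a, F (x + h • noise s x a) ∂(posterior p0 s x) :=
    Measurable.lintegral_kernel_prod_right' hm
  rw [lintegral_map hF measurable_fst,
    lintegral_posteriorStep p0 s h γ (F := fun w => F w.1) (hF.comp measurable_fst)]
  change ∫⁻ w, (fun x => ∫⁻ a, F (x + h • noise s x a) ∂(posterior p0 s x)) w.1 ∂γ = _
  rw [← lintegral_map hm' measurable_fst, hγ, ← Measure.lintegral_compProd hm,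
    noised_compProd_posterior p0 hs, lintegral_map hm (by fun_prop), noised,
    lintegral_map hF (by fun_prop)]
  refine lintegral_congr fun w => ?_
  rw [noise, add_sub_cancel_left, smul_smul s⁻¹, inv_mul_cancel₀ hs.ne', one_smul, add_smul,
    add_assoc]

/-- Expansion of the error of one step: the one-sided Lipschitz bound controls the cross term. -/
lemma sq_norm_step_le {s s₀ h M ω : ℝ} (hs₀ : 0 < s₀) (hs : s₀ ≤ s) (hh : 0 ≤ h)
    {x y y' : E} (hM : ‖velocity p0 s y‖ ≤ M) (hy' : ‖y' - y - h • velocity p0 s y‖ ≤ h * ω) :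
    ‖(x - y') + h • velocity p0 s x‖ ^ 2 ≤ (1 + h * (2 / s₀ + 1)) * ‖x - y‖ ^ 2 +
      (h * ω ^ 2 + 2 * h ^ 2 * ω ^ 2 + 4 * h ^ 2 * M ^ 2) + 4 * h ^ 2 * noiseSq p0 s x := by
  set δ := x - y
  set e := y' - y - h • velocity p0 s y
  set β := velocity p0 s x - velocity p0 s y
  have e1 : (x - y') + h • velocity p0 s x = δ + (h • β - e) := by
    simp only [δ, e, β, smul_sub]
    abel
  have hM0 : 0 ≤ M := (norm_nonneg _).trans hM
  have h1 : inner ℝ δ β ≤ s₀⁻¹ * ‖δ‖ ^ 2 := by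
    rw [real_inner_comm]
    refine (inner_velocity_sub_le p0 (hs₀.trans_le hs) x y).trans ?_
    gcongr
  have h2 : -inner ℝ δ e ≤ ‖δ‖ * (h * ω) := by
    have := neg_le_of_abs_le ((abs_real_inner_le_norm δ e).trans
      (mul_le_mul_of_nonneg_left hy' (norm_nonneg _)))
    linarith
  have h3 : ‖h • β - e‖ ^ 2 ≤ 2 * (h ^ 2 * ‖β‖ ^ 2) + 2 * (h * ω) ^ 2 := by
    have a1 := norm_sub_le (h • β) e
    have a2 : ‖h • β‖ = h * ‖β‖ := by rw [norm_smul, Real.norm_of_nonneg hh]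
    have a3 : ‖h • β - e‖ ≤ h * ‖β‖ + h * ω := by linarith
    have a4 : ‖h • β - e‖ ^ 2 ≤ (h * ‖β‖ + h * ω) ^ 2 := by gcongr
    nlinarith [sq_nonneg (h * ‖β‖ - h * ω)]
  have h4 : ‖β‖ ^ 2 ≤ 2 * noiseSq p0 s x + 2 * M ^ 2 := by
    have a1 := norm_sub_le (velocity p0 s x) (velocity p0 s y)
    have a2 : ‖β‖ ^ 2 ≤ (‖velocity p0 s x‖ + M) ^ 2 := by
      gcongr
      linarith
    nlinarith [sq_nonneg (‖velocity p0 s x‖ - M), sq_norm_velocity_le p0 s x]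
  rw [e1, norm_add_sq_real, inner_sub_right, real_inner_smul_right]
  have h5 : 2 * (h * inner ℝ δ β) ≤ h * (2 / s₀) * ‖δ‖ ^ 2 := by
    calc 2 * (h * inner ℝ δ β) ≤ 2 * (h * (s₀⁻¹ * ‖δ‖ ^ 2)) := by gcongr
      _ = _ := by ring
  have h6 : 2 * (‖δ‖ * (h * ω)) ≤ h * ‖δ‖ ^ 2 + h * ω ^ 2 := by
    nlinarith [mul_nonneg hh (sq_nonneg (‖δ‖ - ω))]
  have h7 : h ^ 2 * ‖β‖ ^ 2 ≤ h ^ 2 * (2 * noiseSq p0 s x + 2 * M ^ 2) := by gcongr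
  nlinarith

lemma trackingError_posteriorStep_le {s s₀ h M ω ρ : ℝ} (hs₀ : 0 < s₀) (hs : s₀ ≤ s) (hh : 0 ≤ h)
    (hM : ∀ y ∈ Metric.closedBall (0 : E) ρ, ‖velocity p0 s (flow p0 s₀ s y)‖ ≤ M)
    (hflow : ∀ y ∈ Metric.closedBall (0 : E) ρ, ‖flow p0 s₀ (s + h) y - flow p0 s₀ s y -
      h • velocity p0 s (flow p0 s₀ s y)‖ ≤ h * ω)
    (γ : Measure (E × E)) [IsProbabilityMeasure γ] (hγ : γ.map Prod.fst = noised p0 s) :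
    trackingError p0 s₀ ρ (s + h) (posteriorStep p0 s h γ) ≤
      ENNReal.ofReal (1 + h * (2 / s₀ + 1)) * trackingError p0 s₀ ρ s γ +
        ENNReal.ofReal (h * ω ^ 2 + 2 * h ^ 2 * ω ^ 2 + 4 * h ^ 2 * M ^ 2 +
          5 * h ^ 2 * Module.finrank ℝ E) := by
  have hs0 : 0 < s := hs₀.trans_le hs
  set B := Metric.closedBall (0 : E) ρ
  set K0 := h * ω ^ 2 + 2 * h ^ 2 * ω ^ 2 + 4 * h ^ 2 * M ^ 2 with hK0
  have hK0n : 0 ≤ K0 := by positivity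
  have hC : 0 ≤ 1 + h * (2 / s₀ + 1) := by positivity
  have hmS := measurable_trackingError_integrand p0 (ρ := ρ) hs₀ hs0
  have hmN : Measurable fun x => ENNReal.ofReal (noiseSq p0 s x) := by
    have : ∀ x, ENNReal.ofReal (noiseSq p0 s x) =
        ∫⁻ a, ENNReal.ofReal (‖noise s x a‖ ^ 2) ∂(posterior p0 s x) := fun x =>
      ofReal_integral_eq_lintegral_ofReal (integrable_sq_noise_posterior p0 s x)
        (ae_of_all _ fun _ => by positivity)
    simp_rw [this]
    refine Measurable.lintegral_kernel_prod_right'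
      (f := fun p : E × E => ENNReal.ofReal (‖noise s p.1 p.2‖ ^ 2)) ?_
    unfold noise
    fun_prop
  have hmN1 : Measurable fun w : E × E => ENNReal.ofReal (noiseSq p0 s w.1) :=
    hmN.comp measurable_fst
  have hpt : ∀ w : E × E, ∫⁻ a, B.indicator (fun y => ENNReal.ofReal
      (‖(w.1 + h • noise s w.1 a) - flow p0 s₀ (s + h) y‖ ^ 2)) w.2 ∂(posterior p0 s w.1) ≤
      ENNReal.ofReal (1 + h * (2 / s₀ + 1)) * B.indicator (fun y => ENNReal.ofReal
        (‖w.1 - flow p0 s₀ s y‖ ^ 2)) w.2 + (ENNReal.ofReal K0 +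
        ENNReal.ofReal (5 * h ^ 2) * ENNReal.ofReal (noiseSq p0 s w.1)) := by
    rintro ⟨x, y⟩
    by_cases hy : y ∈ B
    · simp only [Set.indicator_of_mem hy]
      have e : ∀ a, (x + h • noise s x a) - flow p0 s₀ (s + h) y =
          (x - flow p0 s₀ (s + h) y) + h • noise s x a := fun a => by abel
      simp_rw [e]
      have hN := noiseSq_nonneg p0 s x
      rw [← ofReal_integral_eq_lintegral_ofReal (integrable_norm_add_smul_noise p0 s h x _)
        (ae_of_all _ fun _ => by positivity), ← ENNReal.ofReal_mul hC,
        ← ENNReal.ofReal_mul (by positivity), ← ENNReal.ofReal_add hK0n (by positivity),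
        ← ENNReal.ofReal_add (by positivity) (by positivity)]
      refine ENNReal.ofReal_le_ofReal ?_
      have h1 := integral_norm_add_smul_noise_le p0 s h x (x - flow p0 s₀ (s + h) y)
      have h2 := sq_norm_step_le p0 (x := x) hs₀ hs hh (hM y hy) (hflow y hy)
      linarith
    · simp [Set.indicator_of_notMem hy]
  rw [trackingError, lintegral_posteriorStep p0 s h γ
    (measurable_trackingError_integrand p0 hs₀ (by linarith))]
  refine (lintegral_mono hpt).trans ?_
  rw [lintegral_add_left (hmS.const_mul _), lintegral_const_mul _ hmS,
    lintegral_add_left measurable_const, lintegral_const_mul _ hmN1,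
    ← lintegral_map (f := fun x => ENNReal.ofReal (noiseSq p0 s x)) hmN measurable_fst, hγ,
    lintegral_noiseSq p0 hs0]
  simp only [lintegral_const, measure_univ, mul_one]
  rw [ENNReal.ofReal_add hK0n (by positivity), ENNReal.ofReal_mul (p := 5 * h ^ 2) (by positivity),
    ENNReal.ofReal_natCast]
  rfl

lemma continuousOn_flow_prod {s t : ℝ} (hs : 0 < s) :
    ContinuousOn (fun p : ℝ × E => flow p0 s p.1 p.2) (Set.Icc s t ×ˢ Set.univ) := by
  refine continuousOn_prod_of_continuousOn_lipschitzOnWith' _ (t / s).toNNReal (fun r hr => ?_)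
    fun y _ => ?_
  · refine ((lipschitzWith_flow p0 hs hr.1).weaken ?_).lipschitzOnWith
    gcongr
    exact hr.2
  · exact (continuousOn_flow p0 hs y).mono fun r hr => hs.trans_le hr.1

/-- On a compact set of initial points the speed along the flow is bounded, and the flow is
approximated by its Euler steps to first order, uniformly. -/
lemma exists_euler_bound {s₀ t : ℝ} (hs₀ : 0 < s₀) (ρ : ℝ) :
    ∃ M : ℝ, ∀ ω > 0, ∃ η > 0, ∀ s ∈ Set.Icc s₀ t, ∀ h, 0 ≤ h → h ≤ η → s + h ≤ t →
      ∀ y ∈ Metric.closedBall (0 : E) ρ, ‖velocity p0 s (flow p0 s₀ s y)‖ ≤ M ∧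
        ‖flow p0 s₀ (s + h) y - flow p0 s₀ s y - h • velocity p0 s (flow p0 s₀ s y)‖ ≤ h * ω := by
  have hK : IsCompact (Set.Icc s₀ t ×ˢ Metric.closedBall (0 : E) ρ) :=
    isCompact_Icc.prod (isCompact_closedBall _ _)
  have hcont : ContinuousOn (fun p : ℝ × E => velocity p0 p.1 (flow p0 s₀ p.1 p.2))
      (Set.Icc s₀ t ×ˢ Metric.closedBall (0 : E) ρ) :=
    (continuousOn_velocity p0).comp (f := fun p : ℝ × E => (p.1, flow p0 s₀ p.1 p.2))
      (continuousOn_fst.prodMk ((continuousOn_flow_prod p0 hs₀).mono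
        (Set.prod_mono le_rfl (Set.subset_univ _)))) fun p hp => ⟨hs₀.trans_le hp.1.1, trivial⟩
  obtain ⟨M, hM⟩ := hK.exists_bound_of_continuousOn hcont
  refine ⟨M, fun ω hω => ?_⟩
  obtain ⟨η, hη, huc⟩ := Metric.uniformContinuousOn_iff_le.1
    (hK.uniformContinuousOn_of_continuous hcont) ω hω
  refine ⟨η, hη, fun s hs h hh0 hhη hst y hy => ⟨hM (s, y) ⟨hs, hy⟩, ?_⟩⟩
  have hs0 : 0 < s := hs₀.trans_le hs.1
  set V := velocity p0 s (flow p0 s₀ s y)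
  have hd : ∀ r ∈ Set.Icc s (s + h), HasDerivWithinAt (fun r => flow p0 s₀ r y - r • V)
      (velocity p0 r (flow p0 s₀ r y) - (1 : ℝ) • V) (Set.Icc s (s + h)) r := fun r hr =>
    ((isFlowLine_flow hs₀ y r (hs0.trans_le hr.1)).sub
      ((hasDerivAt_id r).smul_const V)).hasDerivWithinAt
  have hb : ∀ r ∈ Set.Icc s (s + h),
      ‖velocity p0 r (flow p0 s₀ r y) - (1 : ℝ) • V‖ ≤ ω := by
    intro r hr
    rw [one_smul, ← dist_eq_norm]
    refine huc (r, y) ⟨⟨hs.1.trans hr.1, hr.2.trans hst⟩, hy⟩ (s, y) ⟨hs, hy⟩ ?_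
    rw [Prod.dist_eq, dist_self, max_eq_left dist_nonneg, Real.dist_eq, abs_of_nonneg
      (by linarith [hr.1])]
    linarith [hr.2]
  have := (convex_Icc s (s + h)).norm_image_sub_le_of_norm_hasDerivWithin_le hd hb
    (Set.left_mem_Icc.2 (by linarith)) (Set.right_mem_Icc.2 (by linarith))
  rw [add_sub_cancel_left, Real.norm_of_nonneg hh0, mul_comm] at this
  refine le_trans (le_of_eq ?_) this
  congr 1
  rw [add_smul]
  abel

/-- Starting from the diagonal coupling at time `s₀` and making many small posterior steps gives a
coupling of `p_t` and `p_{s₀}` concentrated near the graph of the flow: the variances of the steps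
add up to the order of the step size. -/
lemma exists_coupling_trackingError_le {s₀ t : ℝ} (hs₀ : 0 < s₀) (hst : s₀ ≤ t) (ρ : ℝ) {κ : ℝ}
    (hκ : 0 < κ) :
    ∃ γ : Measure (E × E), γ.map Prod.fst = noised p0 t ∧ γ.map Prod.snd = noised p0 s₀ ∧
      trackingError p0 s₀ ρ t γ ≤ ENNReal.ofReal κ := by
  obtain ⟨M, hM⟩ := exists_euler_bound p0 (t := t) hs₀ ρ
  set C := 2 / s₀ + 1 with hC
  have hC0 : 0 < C := by positivity
  set τ := t - s₀ with hτ
  have hτ0 : 0 ≤ τ := by linarith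
  set d : ℝ := (Module.finrank ℝ E : ℝ) with hd
  -- the final error is at most `exp (C τ) τ (ω² + (2 ω² + 4 M² + 5 d) h)`
  set A := Real.exp (C * τ) * τ with hA
  have hA0 : 0 ≤ A := by positivity
  obtain ⟨ω, hω0, hω⟩ : ∃ ω : ℝ, 0 < ω ∧ A * ω ^ 2 ≤ κ / 2 := by
    refine ⟨√(κ / (2 * (A + 1))), by positivity, ?_⟩
    rw [Real.sq_sqrt (by positivity), mul_div_assoc',
      div_le_div_iff₀ (by positivity) (by positivity)]
    nlinarith
  obtain ⟨η, hη0, hη⟩ := hM ω hω0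
  set D := 2 * ω ^ 2 + 4 * M ^ 2 + 5 * d with hD
  have hD0 : 0 ≤ D := by positivity
  obtain ⟨N, hN⟩ := exists_nat_gt (max (τ / η) (2 * A * D * τ / κ))
  have hNpos : (0 : ℝ) < N := lt_of_le_of_lt (le_max_of_le_left (by positivity)) hN
  have hN1 : τ / η < N := (le_max_left _ _).trans_lt hN
  have hN2 : 2 * A * D * τ / κ < N := (le_max_right _ _).trans_lt hN
  set h := τ / N with hh
  have hh0 : 0 ≤ h := by positivity
  have hNh : N * h = τ := by rw [hh]; field_simp
  have hhη : h ≤ η := by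
    rw [hh, div_le_iff₀ hNpos]
    rw [div_lt_iff₀ hη0] at hN1
    linarith
  set b := h * ω ^ 2 + 2 * h ^ 2 * ω ^ 2 + 4 * h ^ 2 * M ^ 2 + 5 * h ^ 2 * d with hb
  have hb0 : 0 ≤ b := by positivity
  have hind : ∀ i : ℕ, i ≤ N → ∃ γ : Measure (E × E), IsProbabilityMeasure γ ∧
      γ.map Prod.fst = noised p0 (s₀ + i * h) ∧ γ.map Prod.snd = noised p0 s₀ ∧
      trackingError p0 s₀ ρ (s₀ + i * h) γ ≤ ENNReal.ofReal ((1 + h * C) ^ i * (i * b)) := by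
    intro i
    induction i with
    | zero =>
      intro _
      have hm : Measurable fun x : E => (x, x) := by fun_prop
      refine ⟨(noised p0 s₀).map fun x => (x, x), Measure.isProbabilityMeasure_map (by fun_prop),
        ?_, ?_, ?_⟩
      · rw [Measure.map_map measurable_fst hm]
        simp [Function.comp_def]
      · rw [Measure.map_map measurable_snd hm]
        simp [Function.comp_def]
      · simp only [Nat.cast_zero, zero_mul, add_zero, mul_zero, ENNReal.ofReal_zero]
        rw [trackingError, lintegral_map (measurable_trackingError_integrand p0 hs₀ hs₀) hm]
        refine (lintegral_eq_zero_of_ae_eq_zero (ae_of_all _ fun x => ?_)).le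
        refine Set.indicator_apply_eq_zero.2 fun _ => ?_
        simp [flow_self p0 hs₀]
    | succ i ih =>
      intro hi
      obtain ⟨γ, hγ, hγ1, hγ2, hγ3⟩ := ih (by omega)
      have hs : s₀ ≤ s₀ + i * h := by
        have : 0 ≤ i * h := by positivity
        linarith
      have hnext : s₀ + i * h + h = s₀ + (i + 1 : ℕ) * h := by push_cast; ring
      have hle : s₀ + i * h + h ≤ t := by
        have : ((i + 1 : ℕ) : ℝ) * h ≤ N * h := by gcongr
        rw [hnext]
        linarith
      have hbd := hη (s₀ + i * h) ⟨hs, by linarith⟩ h hh0 hhη hle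
      have hfst := map_fst_posteriorStep p0 (hs₀.trans_le hs) h γ hγ1
      rw [hnext] at hfst
      have hprob : IsProbabilityMeasure (posteriorStep p0 (s₀ + i * h) h γ) := by
        have : IsProbabilityMeasure ((posteriorStep p0 (s₀ + i * h) h γ).map Prod.fst) := by
          rw [hfst]; infer_instance
        exact (Measure.isProbabilityMeasure_map_iff (by fun_prop)).1 this
      refine ⟨_, hprob, hfst, (map_snd_posteriorStep p0 _ h γ).trans hγ2, ?_⟩
      have hstep := trackingError_posteriorStep_le p0 (ρ := ρ) hs₀ hs hh0
        (fun y hy => (hbd y hy).1) (fun y hy => (hbd y hy).2) γ hγ1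
      rw [hnext] at hstep
      refine hstep.trans ?_
      have h1C : 0 ≤ 1 + h * C := by positivity
      calc _ ≤ ENNReal.ofReal (1 + h * C) * ENNReal.ofReal ((1 + h * C) ^ i * (i * b)) +
            ENNReal.ofReal b := by gcongr
        _ = ENNReal.ofReal ((1 + h * C) * ((1 + h * C) ^ i * (i * b)) + b) := by
            rw [← ENNReal.ofReal_mul h1C, ← ENNReal.ofReal_add (by positivity) hb0]
        _ ≤ _ := by
            refine ENNReal.ofReal_le_ofReal ?_
            have h1 : 1 ≤ (1 + h * C) ^ (i + 1) := one_le_pow₀ (by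
              have : 0 ≤ h * C := by positivity
              linarith)
            push_cast
            rw [pow_succ] at h1 ⊢
            nlinarith
  obtain ⟨γ, -, h1, h2, h3⟩ := hind N le_rfl
  rw [hNh, hτ, add_sub_cancel] at h1 h3
  refine ⟨γ, h1, h2, h3.trans (ENNReal.ofReal_le_ofReal ?_)⟩
  have hpow : (1 + h * C) ^ N ≤ Real.exp (C * τ) := by
    calc (1 + h * C) ^ N ≤ (Real.exp (h * C)) ^ N := by
          gcongr
          linarith [Real.add_one_le_exp (h * C)]
      _ = Real.exp (C * τ) := by rw [← Real.exp_nat_mul, ← hNh]; ring_nf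
  have hNb : N * b = τ * ω ^ 2 + τ * (h * D) := by
    rw [← hNh, hb, hD]
    ring
  calc (1 + h * C) ^ N * (N * b) ≤ Real.exp (C * τ) * (N * b) := by gcongr
    _ = A * ω ^ 2 + A * D * h := by rw [hNb, hA]; ring
    _ ≤ κ / 2 + κ / 2 := by
        gcongr
        rw [hh, mul_div_assoc', div_le_iff₀ hNpos]
        rw [div_lt_iff₀ hκ] at hN2
        linarith
    _ = κ := by ring

/-- The probability flow carries `p_s` to `p_t`, for `0 < s ≤ t`. -/
theorem map_flow_noised {s t : ℝ} (hs : 0 < s) (hst : s ≤ t) :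
    (noised p0 s).map (flow p0 s t) = noised p0 t := by
  have ht : 0 < t := hs.trans_le hst
  have hmf := measurable_flow p0 hs ht
  have hprob : IsProbabilityMeasure ((noised p0 s).map (flow p0 s t)) :=
    Measure.isProbabilityMeasure_map hmf.aemeasurable
  refine (Measure.ext_of_charFun ?_).symm
  ext ξ
  rw [← sub_eq_zero, ← norm_eq_zero]
  refine le_antisymm (le_of_forall_pos_le_add fun θ hθ => ?_) (norm_nonneg _)
  rw [zero_add]
  -- a ball carrying all but a small part of `p_s`
  obtain ⟨ρ, hρ⟩ : ∃ ρ : ℝ, (noised p0 s).real (Metric.closedBall 0 ρ)ᶜ ≤ θ / 4 := by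
    obtain ⟨k, hk⟩ := exists_lt_measureReal_closedBall (noised p0 s)
      (by linarith : 1 - θ / 4 < 1)
    refine ⟨k, ?_⟩
    rw [probReal_compl_eq_one_sub Metric.isClosed_closedBall.measurableSet]
    linarith
  set τ := θ / (4 * (‖ξ‖ + 1)) with hτ
  have hτ0 : 0 < τ := by positivity
  obtain ⟨γ, h1, h2, h3⟩ := exists_coupling_trackingError_le p0 hs hst ρ
    (by positivity : 0 < τ ^ 2)
  have hγ : IsProbabilityMeasure γ := by
    have : IsProbabilityMeasure (γ.map Prod.fst) := by rw [h1]; infer_instance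
    exact (Measure.isProbabilityMeasure_map_iff (by fun_prop)).1 this
  set B := Metric.closedBall (0 : E) ρ with hB
  have hBm : MeasurableSet B := Metric.isClosed_closedBall.measurableSet
  let e : E → ℂ := fun x => Complex.exp ((inner ℝ x ξ : ℝ) * Complex.I)
  have hen : ∀ x, ‖e x‖ = 1 := fun x => Complex.norm_exp_ofReal_mul_I _
  have hec : Continuous e := by fun_prop
  have hmf2 : Measurable fun w : E × E => flow p0 s t w.2 := hmf.comp measurable_snd
  have hei1 : Integrable (fun w : E × E => e w.1) γ :=
    Integrable.of_bound (C := 1) (by fun_prop) (ae_of_all _ fun w => (hen _).le)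
  have hei2 : Integrable (fun w : E × E => e (flow p0 s t w.2)) γ :=
    Integrable.of_bound (C := 1) (hec.measurable.comp hmf2).aestronglyMeasurable
      (ae_of_all _ fun w => (hen _).le)
  have hlip : ∀ x y, ‖e x - e y‖ ≤ ‖ξ‖ * ‖x - y‖ := by
    intro x y
    have h := Real.norm_exp_I_mul_ofReal_sub_one_le (x := inner ℝ (x - y) ξ)
    have e1 : e x - e y = e y * (Complex.exp (Complex.I * (inner ℝ (x - y) ξ : ℝ)) - 1) := by
      simp only [e]
      rw [mul_sub, mul_one, ← Complex.exp_add, inner_sub_left]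
      push_cast
      ring_nf
    rw [e1, norm_mul, hen, one_mul]
    refine h.trans ((norm_inner_le_norm _ _).trans (le_of_eq (mul_comm _ _)))
  -- the integrable real function dominating the difference
  let S : E × E → ℝ := fun w => B.indicator (fun y => ‖w.1 - flow p0 s t y‖ ^ 2) w.2
  have hS0 : ∀ w, 0 ≤ S w := fun w => Set.indicator_nonneg (fun _ _ => by positivity) _
  have hSm : Measurable S := by
    have : S = (Prod.snd ⁻¹' B).indicator fun w => ‖w.1 - flow p0 s t w.2‖ ^ 2 := rfl
    rw [this]
    exact Measurable.indicator (by fun_prop) (measurable_snd hBm)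
  have hSl : ∫⁻ w, ENNReal.ofReal (S w) ∂γ ≤ ENNReal.ofReal (τ ^ 2) := by
    refine le_trans (le_of_eq ?_) h3
    refine lintegral_congr fun w => ?_
    by_cases hw : w.2 ∈ B
    · simp [S, hw, hB ▸ hw]
    · simp only [S, Set.indicator_of_notMem hw, ENNReal.ofReal_zero]
      rw [Set.indicator_of_notMem hw]
  have hSi : Integrable S γ := by
    refine ⟨hSm.aestronglyMeasurable, ?_⟩
    rw [hasFiniteIntegral_iff_ofReal (ae_of_all _ hS0)]
    exact hSl.trans_lt ENNReal.ofReal_lt_top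
  have hSv : ∫ w, S w ∂γ ≤ τ ^ 2 := by
    rw [integral_eq_lintegral_of_nonneg_ae (ae_of_all _ hS0) hSm.aestronglyMeasurable]
    exact ENNReal.toReal_le_of_le_ofReal (by positivity) hSl
  let J : E × E → ℝ := (Prod.snd ⁻¹' Bᶜ).indicator fun _ => 1
  have hJm : MeasurableSet (Prod.snd ⁻¹' Bᶜ : Set (E × E)) := measurable_snd hBm.compl
  have hJi : Integrable J γ := (integrable_const _).indicator hJm
  have hJv : ∫ w, J w ∂γ ≤ θ / 4 := by
    rw [integral_indicator hJm, setIntegral_const, smul_eq_mul, mul_one]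
    refine le_trans (le_of_eq ?_) hρ
    rw [measureReal_def, measureReal_def, ← h2, Measure.map_apply measurable_snd hBm.compl]
  have hdom : ∀ w, ‖e w.1 - e (flow p0 s t w.2)‖ ≤ ‖ξ‖ * (τ⁻¹ * S w + τ) + 2 * J w := by
    intro w
    by_cases hw : w.2 ∈ B
    · have hJw : J w = 0 := Set.indicator_of_notMem (by simpa using hw) _
      have hSw : S w = ‖w.1 - flow p0 s t w.2‖ ^ 2 := Set.indicator_of_mem hw _
      rw [hJw, hSw, mul_zero, add_zero]
      refine (hlip _ _).trans ?_
      gcongr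
      set r := ‖w.1 - flow p0 s t w.2‖
      have : τ⁻¹ * r ^ 2 + τ - r = τ⁻¹ * ((r - τ / 2) ^ 2 + 3 / 4 * τ ^ 2) := by
        field_simp
        ring
      have h0 : 0 ≤ τ⁻¹ * ((r - τ / 2) ^ 2 + 3 / 4 * τ ^ 2) := by positivity
      linarith
    · have hJw : J w = 1 := Set.indicator_of_mem (by simpa using hw) _
      have hSw : S w = 0 := Set.indicator_of_notMem hw _
      rw [hJw, hSw]
      refine (norm_sub_le _ _).trans ?_
      rw [hen, hen]
      have : 0 ≤ ‖ξ‖ * (τ⁻¹ * 0 + τ) := by positivity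
      linarith
  have hcalc : ‖charFun (noised p0 t) ξ - charFun ((noised p0 s).map (flow p0 s t)) ξ‖ ≤
      ∫ w, (‖ξ‖ * (τ⁻¹ * S w + τ) + 2 * J w) ∂γ := by
    have c1 : charFun (noised p0 t) ξ = ∫ w, e w.1 ∂γ := by
      rw [charFun_apply, ← h1, integral_map (by fun_prop) hec.aestronglyMeasurable]
    have c2 : charFun ((noised p0 s).map (flow p0 s t)) ξ = ∫ w, e (flow p0 s t w.2) ∂γ := by
      rw [charFun_apply, integral_map hmf.aemeasurable hec.aestronglyMeasurable, ← h2,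
        integral_map (f := fun y => e (flow p0 s t y)) (by fun_prop)
          (hec.measurable.comp hmf).aestronglyMeasurable]
    rw [c1, c2, ← integral_sub hei1 hei2]
    refine norm_integral_le_of_norm_le ?_ (ae_of_all _ hdom)
    exact (((hSi.const_mul _).add (integrable_const _)).const_mul _).add (hJi.const_mul _)
  refine hcalc.trans ?_
  have hi1 : Integrable (fun w => τ⁻¹ * S w) γ := hSi.const_mul _
  have e1 := integral_add hi1 (integrable_const (μ := γ) τ)
  have e2 := integral_add ((hi1.add (integrable_const (μ := γ) τ)).const_mul ‖ξ‖)
    (hJi.const_mul 2)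
  simp only [Pi.add_apply] at e1 e2 ⊢
  rw [e2, integral_const_mul, e1, integral_const_mul, integral_const_mul]
  simp only [integral_const, probReal_univ, one_smul]
  have : τ⁻¹ * ∫ w, S w ∂γ ≤ τ := by
    rw [inv_mul_le_iff₀ hτ0, ← sq]
    exact hSv
  have hξ : ‖ξ‖ * (τ + τ) ≤ θ / 2 := by
    have h8 : (‖ξ‖ + 1) * τ = θ / 4 := by rw [hτ]; field_simp
    nlinarith
  calc _ ≤ ‖ξ‖ * (τ + τ) + 2 * (θ / 4) := by gcongr
    _ ≤ θ := by linarith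

end Transport

/-! ### Trajectories down to the initial time and the law of the consistency function -/

section InitialTime

variable {E : Type*} [NormedAddCommGroup E] [InnerProductSpace ℝ E] [FiniteDimensional ℝ E]
  [MeasurableSpace E] [BorelSpace E] (p0 : Measure E) [IsProbabilityMeasure p0]

lemma map_flow_noised_backward {s t : ℝ} (hs : 0 < s) (hst : s ≤ t) :
    (noised p0 t).map (flow p0 t s) = noised p0 s := by
  have ht : 0 < t := hs.trans_le hst
  rw [← map_flow_noised p0 hs hst,
    Measure.map_map (measurable_flow p0 ht hs) (measurable_flow p0 hs ht)]
  have : flow p0 t s ∘ flow p0 s t = id := funext (flow_flow_cancel p0 hs ht)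
  rw [this, Measure.map_id]

/-- The velocity at time `u > 0` along the flow line through `y` at time `T`. The time is written
as `exp (log u)` so that the expression is jointly measurable on all of `ℝ × E`. -/
noncomputable def flowVelocity (T u : ℝ) (y : E) : E :=
  velocity p0 (Real.exp (Real.log u)) (flow p0 T (Real.exp (Real.log u)) y)

lemma flowVelocity_of_pos {u : ℝ} (hu : 0 < u) (T : ℝ) (y : E) :
    flowVelocity p0 T u y = velocity p0 u (flow p0 T u y) := by
  rw [flowVelocity, Real.exp_log hu]

lemma measurable_flowVelocity {T : ℝ} (hT : 0 < T) :
    Measurable (Function.uncurry (flowVelocity p0 T)) := by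
  have h : Measurable (Function.uncurry fun (τ : ℝ) (y : E) =>
      velocity p0 (Real.exp τ) (flow p0 T (Real.exp τ) y)) := by
    refine measurable_uncurry_of_continuous_of_measurable (fun y => ?_) fun τ =>
      (measurable_velocity p0 _).comp (measurable_flow p0 hT (Real.exp_pos τ))
    have h1 : Continuous fun τ : ℝ => flow p0 T (Real.exp τ) y :=
      (continuousOn_flow p0 hT y).comp_continuous Real.continuous_exp fun τ => Real.exp_pos τ
    have h2 : Continuous fun τ : ℝ => (Real.exp τ, flow p0 T (Real.exp τ) y) :=
      Real.continuous_exp.prodMk h1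
    exact (continuousOn_velocity p0).comp_continuous h2 fun τ => ⟨Real.exp_pos τ, trivial⟩
  have hlog : Measurable fun p : ℝ × E => (Real.log p.1, p.2) := by fun_prop
  have := h.comp hlog
  simpa only [Function.comp_def, Function.uncurry_def, flowVelocity] using this

/-- Almost every flow line has finite length down to time `0`, because the mean speed is bounded
uniformly in time. -/
lemma ae_integrableOn_flowVelocity {T : ℝ} (hT : 0 < T) :
    ∀ᵐ y ∂(noised p0 T), IntegrableOn (fun u => flowVelocity p0 T u y) (Set.Ioc 0 T) := by
  have hm := measurable_flowVelocity p0 hT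
  have hm2 : Measurable fun p : E × ℝ => ENNReal.ofReal ‖flowVelocity p0 T p.2 p.1‖ := by
    have := hm.comp (measurable_swap (α := E) (β := ℝ))
    exact this.norm.ennreal_ofReal
  have hfin : ∫⁻ y, (∫⁻ u in Set.Ioc 0 T, ENNReal.ofReal ‖flowVelocity p0 T u y‖)
      ∂(noised p0 T) ≠ ∞ := by
    rw [lintegral_lintegral_swap (μ := noised p0 T) (ν := volume.restrict (Set.Ioc 0 T))
      (f := fun y u => ENNReal.ofReal ‖flowVelocity p0 T u y‖) hm2.aemeasurable]
    have hb : ∀ u ∈ Set.Ioc 0 T, ∫⁻ y, ENNReal.ofReal ‖flowVelocity p0 T u y‖ ∂(noised p0 T) ≤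
        1 + Module.finrank ℝ E := by
      intro u hu
      refine le_trans (le_of_eq ?_) (lintegral_norm_velocity_le p0 hu.1)
      rw [← map_flow_noised_backward p0 hu.1 hu.2, lintegral_map (by fun_prop)
        (measurable_flow p0 hT hu.1)]
      simp_rw [flowVelocity_of_pos p0 hu.1]
    refine ((setLIntegral_mono measurable_const hb).trans_lt ?_).ne
    rw [setLIntegral_const]
    exact ENNReal.mul_lt_top (by simp) (by simp)
  filter_upwards [ae_lt_top hm2.lintegral_prod_right' hfin] with y hy
  refine ⟨(hm.comp (measurable_id.prodMk measurable_const)).aestronglyMeasurable, ?_⟩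
  rw [hasFiniteIntegral_iff_norm]
  exact hy

/-- A curve that solves the probability-flow equation on `(ε, T]` and is continuous on `[ε, T]`,
in terms of `velocity`. -/
def IsVelocityTrajectory (ε T : ℝ) (x : ℝ → E) : Prop :=
  ContinuousOn x (Set.Icc ε T) ∧
    ∀ t ∈ Set.Ioc ε T, HasDerivWithinAt x (velocity p0 t (x t)) (Set.Icc ε T) t

/-- The end point at time `0` of the flow line through `y` at time `T`, if that line has finite
length. -/
noncomputable def flowOrigin (T : ℝ) (y : E) : E := y - ∫ u in Set.Ioc 0 T, flowVelocity p0 T u y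

lemma measurable_flowOrigin {T : ℝ} (hT : 0 < T) : Measurable (flowOrigin p0 T) := by
  unfold flowOrigin
  have hm : StronglyMeasurable fun p : E × ℝ => flowVelocity p0 T p.2 p.1 :=
    ((measurable_flowVelocity p0 hT).comp (measurable_swap (α := E) (β := ℝ))).stronglyMeasurable
  exact measurable_id.sub (StronglyMeasurable.integral_prod_right' hm).measurable

lemma exists_trajectory_of_integrableOn {T : ℝ} (hT : 0 < T) {y : E}
    (hy : IntegrableOn (fun u => flowVelocity p0 T u y) (Set.Ioc 0 T)) :
    ∃ x : ℝ → E, IsVelocityTrajectory p0 0 T x ∧ (∀ t ∈ Set.Ioc 0 T, x t = flow p0 T t y) ∧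
      x 0 = flowOrigin p0 T y := by
  have hI : IntegrableOn (fun u => flowVelocity p0 T u y) (Set.uIcc 0 T) := by
    rwa [Set.uIcc_of_le hT.le, integrableOn_Icc_iff_integrableOn_Ioc]
  have hflow : ∀ t ∈ Set.Ioc 0 T, y - ∫ u in t..T, flowVelocity p0 T u y = flow p0 T t y := by
    intro t ht
    have hsub : Set.uIcc t T ⊆ Set.uIcc 0 T := by
      rw [Set.uIcc_of_le ht.2, Set.uIcc_of_le hT.le]
      exact Set.Icc_subset_Icc_left ht.1.le
    have hd : ∀ u ∈ Set.uIcc t T,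
        HasDerivAt (fun r => flow p0 T r y) (flowVelocity p0 T u y) u := by
      intro u hu
      rw [Set.uIcc_of_le ht.2] at hu
      have hu0 : 0 < u := ht.1.trans_le hu.1
      rw [flowVelocity_of_pos p0 hu0]
      exact isFlowLine_flow hT y u hu0
    rw [intervalIntegral.integral_eq_sub_of_hasDerivAt hd
      ((hI.mono_set hsub).intervalIntegrable), flow_self p0 hT, sub_sub_cancel]
  refine ⟨fun r => y - ∫ u in r..T, flowVelocity p0 T u y, ⟨?_, ?_⟩, hflow, ?_⟩
  · rw [← Set.uIcc_of_le hT.le]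
    exact continuousOn_const.sub (intervalIntegral.continuousOn_primitive_interval_left hI)
  · intro t ht
    have hev : (fun r => y - ∫ u in r..T, flowVelocity p0 T u y) =ᶠ[𝓝[Set.Icc 0 T] t]
        fun r => flow p0 T r y := by
      filter_upwards [self_mem_nhdsWithin, mem_nhdsWithin_of_mem_nhds (Ioi_mem_nhds ht.1)]
        with r hr hr0
      exact hflow r ⟨hr0, hr.2⟩
    beta_reduce
    rw [hflow t ht]
    exact ((isFlowLine_flow hT y t ht.1).hasDerivWithinAt).congr_of_eventuallyEq hev (hflow t ht)
  · simp only [flowOrigin]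
    rw [intervalIntegral.integral_of_le hT.le]

/-- The end points at time `0` of the flow lines are distributed like the data: pass to the limit
`s → 0` in the law `p_s` of the positions at time `s`. -/
lemma map_flowOrigin {T : ℝ} (hT : 0 < T) : (noised p0 T).map (flowOrigin p0 T) = p0 := by
  have hm := measurable_flowOrigin p0 hT
  have : IsProbabilityMeasure ((noised p0 T).map (flowOrigin p0 T)) :=
    Measure.isProbabilityMeasure_map hm.aemeasurable
  refine Measure.ext_of_charFun ?_
  ext ξ
  let e : E → ℂ := fun x => Complex.exp ((inner ℝ x ξ : ℝ) * Complex.I)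
  have hen : ∀ x, ‖e x‖ ≤ 1 := fun x => (Complex.norm_exp_ofReal_mul_I _).le
  have hec : Continuous e := by fun_prop
  have hIoc : ∀ᶠ s in 𝓝[>] (0 : ℝ), s ∈ Set.Ioc 0 T := Ioc_mem_nhdsGT hT
  have hlim1 : Tendsto (fun s => ∫ y, e (flow p0 T s y) ∂(noised p0 T)) (𝓝[>] 0)
      (𝓝 (∫ y, e (flowOrigin p0 T y) ∂(noised p0 T))) := by
    refine tendsto_integral_filter_of_dominated_convergence (fun _ => 1) ?_
      (Eventually.of_forall fun s => ae_of_all _ fun y => hen _) (integrable_const _) ?_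
    · filter_upwards [hIoc] with s hs
      exact (hec.measurable.comp (measurable_flow p0 hT hs.1)).aestronglyMeasurable
    · filter_upwards [ae_integrableOn_flowVelocity p0 hT] with y hy
      obtain ⟨x, ⟨hxc, -⟩, hx, hx0⟩ := exists_trajectory_of_integrableOn p0 hT hy
      rw [← hx0]
      refine (hec.tendsto _).comp ?_
      have h1 : Tendsto x (𝓝[>] 0) (𝓝 (x 0)) :=
        (hxc 0 ⟨le_rfl, hT.le⟩).mono_left (nhdsWithin_le_of_mem
          (mem_of_superset (Ioc_mem_nhdsGT hT) Set.Ioc_subset_Icc_self))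
      refine h1.congr' ?_
      filter_upwards [hIoc] with s hs
      exact hx s hs
  have hlim2 : Tendsto (fun s : ℝ => ∫ w, e (w.1 + s • w.2) ∂(p0.prod (stdGaussian E))) (𝓝[>] 0)
      (𝓝 (∫ w, e (w.1 + (0 : ℝ) • w.2) ∂(p0.prod (stdGaussian E)))) := by
    refine tendsto_integral_filter_of_dominated_convergence (fun _ => 1)
      (Eventually.of_forall fun s => by fun_prop)
      (Eventually.of_forall fun s => ae_of_all _ fun y => hen _) (integrable_const _)
      (ae_of_all _ fun w => ?_)
    have : Continuous fun s : ℝ => e (w.1 + s • w.2) := by fun_prop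
    exact (this.tendsto 0).mono_left nhdsWithin_le_nhds
  have heq : (fun s => ∫ y, e (flow p0 T s y) ∂(noised p0 T)) =ᶠ[𝓝[>] 0]
      fun s : ℝ => ∫ w, e (w.1 + s • w.2) ∂(p0.prod (stdGaussian E)) := by
    filter_upwards [hIoc] with s hs
    rw [← integral_map (φ := flow p0 T s) (f := e) (measurable_flow p0 hT hs.1).aemeasurable
      hec.aestronglyMeasurable, map_flow_noised_backward p0 hs.1 hs.2, noised,
      integral_map (by fun_prop) hec.aestronglyMeasurable]
  have h := tendsto_nhds_unique (hlim1.congr' heq) hlim2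
  rw [charFun_apply, charFun_apply, integral_map hm.aemeasurable hec.aestronglyMeasurable]
  refine h.trans ?_
  rw [← integral_map (φ := fun w : E × E => w.1 + (0 : ℝ) • w.2) (f := e) (by fun_prop)
    hec.aestronglyMeasurable]
  change ∫ x, e x ∂(noised p0 0) = _
  rw [noised_zero]

/-- For almost every end point at time `T` there is a trajectory down to time `ε`, and its initial
point is distributed according to `p_ε`. -/
theorem exists_initial_map {ε T : ℝ} (hε : 0 ≤ ε) (hT : ε < T) :
    ∃ Z : E → E, Measurable Z ∧ (noised p0 T).map Z = noised p0 ε ∧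
      ∀ᵐ y ∂(noised p0 T), ∃ x : ℝ → E, IsVelocityTrajectory p0 ε T x ∧
        (∀ t ∈ Set.Ioc ε T, x t = flow p0 T t y) ∧ x ε = Z y := by
  have hT0 : 0 < T := hε.trans_lt hT
  rcases hε.eq_or_lt with rfl | hε0
  · refine ⟨flowOrigin p0 T, measurable_flowOrigin p0 hT0, ?_, ?_⟩
    · rw [map_flowOrigin p0 hT0, noised_zero]
    · filter_upwards [ae_integrableOn_flowVelocity p0 hT0] with y hy
      exact exists_trajectory_of_integrableOn p0 hT0 hy
  · refine ⟨flow p0 T ε, measurable_flow p0 hT0 hε0, map_flow_noised_backward p0 hε0 hT.le,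
      ae_of_all _ fun y => ⟨fun t => flow p0 T t y, ⟨?_, fun t ht => ?_⟩, fun t _ => rfl, rfl⟩⟩
    · exact (continuousOn_flow p0 hT0 y).mono fun t ht => hε0.trans_le ht.1
    · exact (isFlowLine_flow hT0 y t (hε0.trans ht.1)).hasDerivWithinAt

end InitialTime

section ConsistencyLaw

variable {n : ℕ} (p0 : Measure (EuclideanSpace ℝ (Fin n))) [IsProbabilityMeasure p0]

lemma IsVelocityTrajectory.isTrajectory {ε T : ℝ} (hε : 0 ≤ ε) {x : ℝ → EuclideanSpace ℝ (Fin n)}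
    (hx : IsVelocityTrajectory p0 ε T x) : IsTrajectory p0 ε T x :=
  ⟨hx.1, fun t ht => by
    rw [neg_smul_score p0 (hε.trans_lt ht.1)]
    exact hx.2 t ht⟩

/-- A consistency function carries `p_t` to `p_ε`. No measurability of `g` is assumed: it is almost
everywhere the measurable map `Z` composed with the inverse of the flow. -/
theorem consistencyLaw_eq {ε T : ℝ} (hε : 0 ≤ ε) (hT : ε < T)
    {g : EuclideanSpace ℝ (Fin n) → ℝ → EuclideanSpace ℝ (Fin n)}
    (hg : IsConsistencyFunction p0 ε T g) {t : ℝ} (ht : t ∈ Set.Icc ε T) :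
    consistencyLaw p0 g t = smoothed p0 ε := by
  rw [consistencyLaw]
  rcases ht.1.eq_or_lt with rfl | hεt
  · simp only [hg.initial]
    exact Measure.map_id
  · rw [smoothed_eq_noised, smoothed_eq_noised]
    have ht0 : 0 < t := hε.trans_lt hεt
    have hT0 : 0 < T := hε.trans_lt hT
    obtain ⟨Z, hZm, hZ, hx⟩ := exists_initial_map p0 hε hT
    have hgZ : (fun y => g y t) ∘ flow p0 T t =ᵐ[noised p0 T] Z := by
      filter_upwards [hx] with y ⟨x, hxt, hxf, hxε⟩
      have := hg.const_on_trajectory x (hxt.isTrajectory p0 hε) t ht ε ⟨le_rfl, hT.le⟩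
      rw [hg.initial, hxf t ⟨hεt, ht.2⟩, hxε] at this
      exact this
    have hemb := measurableEmbedding_flow p0 hT0 ht0
    have hgm : AEMeasurable (fun y => g y t) ((noised p0 T).map (flow p0 T t)) :=
      hemb.aemeasurable_map_iff.2 (hZm.aemeasurable.congr hgZ.symm)
    rw [← map_flow_noised_backward p0 ht0 ht.2,
      AEMeasurable.map_map_of_aemeasurable hgm hemb.measurable.aemeasurable,
      Measure.map_congr hgZ, hZ]

end ConsistencyLaw

/-! ### The Wasserstein distance -/

section Wasserstein

variable {n : ℕ}

lemma IsCoupling.isProbabilityMeasure {E : Type*} [MeasurableSpace E] {γ : Measure (E × E)}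
    {μ ν : Measure E} [IsProbabilityMeasure μ] (h : IsCoupling γ μ ν) : IsProbabilityMeasure γ := by
  have : IsProbabilityMeasure (γ.map Prod.fst) := by rw [h.1]; infer_instance
  exact (Measure.isProbabilityMeasure_map_iff (by fun_prop)).1 this

lemma wasserstein_le_of_coupling {μ ν : Measure (EuclideanSpace ℝ (Fin n))}
    {γ : Measure (EuclideanSpace ℝ (Fin n) × EuclideanSpace ℝ (Fin n))} (h : IsCoupling γ μ ν) :
    wasserstein μ ν ≤ ∫⁻ w, ENNReal.ofReal ‖w.1 - w.2‖ ∂γ :=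
  iInf₂_le γ h

/-- Two random vectors on the same space bound the distance of their laws. -/
lemma wasserstein_map_le {Ω : Type*} [MeasurableSpace Ω] (P : Measure Ω)
    {X Y : Ω → EuclideanSpace ℝ (Fin n)} (hX : Measurable X) (hY : Measurable Y) :
    wasserstein (P.map X) (P.map Y) ≤ ∫⁻ ω, ENNReal.ofReal ‖X ω - Y ω‖ ∂P := by
  have hXY : Measurable fun ω => (X ω, Y ω) := hX.prodMk hY
  refine (wasserstein_le_of_coupling (γ := P.map fun ω => (X ω, Y ω)) ⟨?_, ?_⟩).trans ?_
  · rw [Measure.map_map measurable_fst hXY]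
    rfl
  · rw [Measure.map_map measurable_snd hXY]
    rfl
  · rw [lintegral_map (by fun_prop) hXY]

/-- Gluing of couplings: disintegrate the second one over the middle marginal. -/
lemma wasserstein_triangle (μ ν ρ : Measure (EuclideanSpace ℝ (Fin n))) [IsProbabilityMeasure μ]
    [IsProbabilityMeasure ν] :
    wasserstein μ ρ ≤ wasserstein μ ν + wasserstein ν ρ := by
  simp only [wasserstein, ENNReal.iInf_add, ENNReal.add_iInf]
  refine le_iInf₂ fun γ₂ h₂ => le_iInf₂ fun γ₁ h₁ => ?_
  have := h₁.isProbabilityMeasure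
  have := h₂.isProbabilityMeasure
  set κ := γ₂.condKernel.comap Prod.snd (measurable_snd (α := EuclideanSpace ℝ (Fin n))) with hκ
  -- the pair of the last two coordinates is distributed according to `γ₂`
  have hglue : ∀ F : EuclideanSpace ℝ (Fin n) × EuclideanSpace ℝ (Fin n) → ℝ≥0∞, Measurable F →
      ∫⁻ p, F (p.1.2, p.2) ∂(γ₁ ⊗ₘ κ) = ∫⁻ w, F w ∂γ₂ := by
    intro F hF
    have hF1 : Measurable fun p : (EuclideanSpace ℝ (Fin n) × EuclideanSpace ℝ (Fin n)) ×
        EuclideanSpace ℝ (Fin n) => F (p.1.2, p.2) := by fun_prop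
    have hF2 : Measurable fun y => ∫⁻ z, F (y, z) ∂(γ₂.condKernel y) :=
      hF.lintegral_kernel_prod_right'
    have hfst : γ₁.map Prod.snd = γ₂.fst := by rw [h₁.2, Measure.fst, h₂.1]
    rw [Measure.lintegral_compProd hF1]
    simp only [hκ, Kernel.comap_apply]
    rw [← lintegral_map (f := fun y => ∫⁻ z, F (y, z) ∂(γ₂.condKernel y)) hF2 measurable_snd, hfst,
      ← Measure.lintegral_compProd hF, γ₂.disintegrate]
  have hm1 : (γ₁ ⊗ₘ κ).map (fun p => p.1.1) = μ := by
    have h := Measure.fst_compProd γ₁ κ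
    rw [Measure.fst] at h
    rw [← h₁.1]
    conv_rhs => rw [← h]
    rw [Measure.map_map (by fun_prop) (by fun_prop)]
    rfl
  have hm2 : (γ₁ ⊗ₘ κ).map (fun p => p.2) = ρ := by
    rw [← h₂.2]
    refine Measure.ext_of_lintegral _ fun F hF => ?_
    rw [lintegral_map hF (by fun_prop), lintegral_map hF (by fun_prop)]
    exact hglue (fun w => F w.2) (by fun_prop)
  have h := wasserstein_map_le (γ₁ ⊗ₘ κ) (X := fun p => p.1.1) (Y := fun p => p.2) (by fun_prop)
    (by fun_prop)
  rw [hm1, hm2] at h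
  refine h.trans ?_
  calc _ ≤ ∫⁻ p, (ENNReal.ofReal ‖p.1.1 - p.1.2‖ + ENNReal.ofReal ‖p.1.2 - p.2‖) ∂(γ₁ ⊗ₘ κ) := by
        refine lintegral_mono fun p => ?_
        rw [← ENNReal.ofReal_add (norm_nonneg _) (norm_nonneg _)]
        exact ENNReal.ofReal_le_ofReal (norm_sub_le_norm_sub_add_norm_sub _ _ _)
    _ = ∫⁻ w, ENNReal.ofReal ‖w.1 - w.2‖ ∂γ₁ + ∫⁻ w, ENNReal.ofReal ‖w.1 - w.2‖ ∂γ₂ := by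
        rw [lintegral_add_left (by fun_prop), hglue (fun w => ENNReal.ofReal ‖w.1 - w.2‖)
          (by fun_prop), Measure.lintegral_compProd (by fun_prop)]
        simp

lemma wasserstein_map_le_of_lipschitz {f : EuclideanSpace ℝ (Fin n) → EuclideanSpace ℝ (Fin n)}
    {L : ℝ} (hL : 0 < L) (hf : ∀ x y, ‖f x - f y‖ ≤ L * ‖x - y‖)
    (μ ν : Measure (EuclideanSpace ℝ (Fin n))) :
    wasserstein (μ.map f) (ν.map f) ≤ ENNReal.ofReal L * wasserstein μ ν := by
  have hfm : Measurable f := (LipschitzWith.of_dist_le_mul (K := L.toNNReal) fun x y => by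
    rw [Real.coe_toNNReal _ hL.le, dist_eq_norm, dist_eq_norm]
    exact hf x y).continuous.measurable
  have h0 : ENNReal.ofReal L ≠ 0 := by simpa using hL
  simp only [wasserstein, ENNReal.mul_iInf_of_ne h0 ENNReal.ofReal_ne_top]
  refine le_iInf₂ fun γ hγ => ?_
  have h := wasserstein_map_le γ (X := fun w => f w.1) (Y := fun w => f w.2) (by fun_prop)
    (by fun_prop)
  have e1 : γ.map (fun w => f w.1) = μ.map f := by
    rw [← hγ.1, Measure.map_map hfm measurable_fst]
    rfl
  have e2 : γ.map (fun w => f w.2) = ν.map f := by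
    rw [← hγ.2, Measure.map_map hfm measurable_snd]
    rfl
  rw [e1, e2] at h
  refine h.trans ?_
  rw [← lintegral_const_mul _ (by fun_prop)]
  refine lintegral_mono fun w => ?_
  rw [← ENNReal.ofReal_mul hL.le]
  exact ENNReal.ofReal_le_ofReal (hf _ _)

end Wasserstein

/-! ### The training loss bounds the distance to the data -/

section Loss

variable {n : ℕ}

lemma TimeGrid.mem_Icc {ε T : ℝ} (G : TimeGrid ε T) {k : ℕ} (hk : k ≤ G.N) :
    G.time k ∈ Set.Icc ε T := by
  have hmono : ∀ i j, i ≤ j → j ≤ G.N → G.time i ≤ G.time j := by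
    intro i j hij
    induction j, hij using Nat.le_induction with
    | base => exact fun _ => le_rfl
    | succ j _ ih => exact fun hj => (ih (by omega)).trans (G.time_lt j (by omega)).le
  refine ⟨?_, ?_⟩
  · simpa [G.time_zero] using hmono 0 k (by omega) hk
  · simpa [G.time_last] using hmono k G.N hk le_rfl

lemma model_initial {Θ : Type*}
    (F : Θ → EuclideanSpace ℝ (Fin n) → ℝ → EuclideanSpace ℝ (Fin n)) (ε : ℝ)
    (x : EuclideanSpace ℝ (Fin n)) (θ : Θ) : model F ε x ε θ = x := by
  norm_num [model]

lemma wasserstein_smoothed_le (p0 : Measure (EuclideanSpace ℝ (Fin n))) [IsProbabilityMeasure p0]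
    {ε : ℝ} (hε : 0 ≤ ε) : wasserstein (smoothed p0 ε) p0 ≤ ENNReal.ofReal (ε * √n) := by
  have h := wasserstein_map_le (p0.prod (stdGaussian (EuclideanSpace ℝ (Fin n))))
    (X := fun w => w.1 + ε • w.2) (Y := Prod.fst) (by fun_prop) (by fun_prop)
  have e : (p0.prod (stdGaussian (EuclideanSpace ℝ (Fin n)))).map Prod.fst = p0 :=
    Measure.fst_prod
  rw [e] at h
  rw [smoothed_eq_noised]
  refine h.trans ?_
  simp only [add_sub_cancel_left, norm_smul, Real.norm_of_nonneg hε, ENNReal.ofReal_mul hε]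
  rw [lintegral_const_mul _ (by fun_prop), lintegral_prod _ (by fun_prop)]
  simp only [lintegral_const, measure_univ, mul_one]
  gcongr
  simpa using lintegral_norm_stdGaussian_le (E := EuclideanSpace ℝ (Fin n))

/-- Coupling `a + t_k z` with `a + ε z` through the same data point and the same noise, the
telescoping sum of the increments of `f` is exactly what the training loss measures. -/
lemma wasserstein_generated_le_ctLoss {Θ : Type*} {ε T : ℝ}
    (p0 : Measure (EuclideanSpace ℝ (Fin n))) [IsProbabilityMeasure p0]
    {d : EuclideanSpace ℝ (Fin n) → EuclideanSpace ℝ (Fin n) → ℝ}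
    (hdm : Measurable (Function.uncurry d)) (hd : ∀ x y, ‖x - y‖ ≤ d x y)
    {f : EuclideanSpace ℝ (Fin n) → ℝ → Θ → EuclideanSpace ℝ (Fin n)} {θ : Θ}
    (hf : ∀ t ∈ Set.Icc ε T, Measurable fun x => f x t θ) (hf0 : ∀ x, f x ε θ = x)
    (G : TimeGrid ε T) {k : ℕ} (hk : k ≤ G.N) :
    wasserstein (generated f θ (smoothed p0 (G.time k)) (G.time k)) (smoothed p0 ε) ≤
      ctLoss p0 d f θ θ G k := by
  let X : ℕ → EuclideanSpace ℝ (Fin n) × EuclideanSpace ℝ (Fin n) → EuclideanSpace ℝ (Fin n) :=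
    fun i w => f (w.1 + G.time i • w.2) (G.time i) θ
  have hXm : ∀ i ≤ G.N, Measurable (X i) := fun i hi =>
    (hf _ (G.mem_Icc hi)).comp (by fun_prop)
  have hlaw : ∀ i ≤ G.N, generated f θ (smoothed p0 (G.time i)) (G.time i) =
      (p0.prod (stdGaussian (EuclideanSpace ℝ (Fin n)))).map (X i) := fun i hi => by
    rw [generated, smoothed_eq_noised, noised, Measure.map_map (hf _ (G.mem_Icc hi)) (by fun_prop)]
    rfl
  have hlaw0 : smoothed p0 ε =
      (p0.prod (stdGaussian (EuclideanSpace ℝ (Fin n)))).map (X 0) := by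
    rw [smoothed_eq_noised, noised]
    simp only [X, G.time_zero, hf0]
  rw [hlaw k hk, hlaw0]
  refine (wasserstein_map_le _ (hXm k hk) (hXm 0 (by omega))).trans ?_
  have htel : ∀ j ≤ k, ∀ w, ENNReal.ofReal ‖X j w - X 0 w‖ ≤
      ∑ i ∈ Finset.range j, ENNReal.ofReal (d (X (i + 1) w) (X i w)) := by
    intro j
    induction j with
    | zero => simp
    | succ j ih =>
      intro hj w
      rw [Finset.sum_range_succ, add_comm (Finset.sum _ _)]
      refine le_trans ?_ (add_le_add le_rfl (ih (by omega) w))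
      rw [← ENNReal.ofReal_add ((norm_nonneg _).trans (hd _ _)) (norm_nonneg _)]
      refine ENNReal.ofReal_le_ofReal ?_
      exact (norm_sub_le_norm_sub_add_norm_sub _ (X j w) _).trans
        (add_le_add (hd _ _) le_rfl)
  refine (lintegral_mono (htel k le_rfl)).trans (le_of_eq ?_)
  rw [lintegral_finsetSum' _ fun i hi => ?_]
  · rfl
  · have hi' := Finset.mem_range.1 hi
    have h2 : Measurable fun w => (X (i + 1) w, X i w) :=
      (hXm (i + 1) (by omega)).prodMk (hXm i (by omega))
    exact (hdm.comp h2).ennreal_ofReal.aemeasurable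

end Loss

end ConsistencyModel

theorem theorem3p1 {n : ℕ}
    -- the data distribution and the time interval
    (p0 : Measure (EuclideanSpace ℝ (Fin n))) [IsProbabilityMeasure p0]
    (ε T : ℝ) (hε : 0 ≤ ε) (hT : ε < T)
    -- the consistency function of the probability-flow equation
    (g : EuclideanSpace ℝ (Fin n) → ℝ → EuclideanSpace ℝ (Fin n))
    (hg : ConsistencyModel.IsConsistencyFunction p0 ε T g)
    -- the distance function in the loss
    (d : EuclideanSpace ℝ (Fin n) → EuclideanSpace ℝ (Fin n) → ℝ)
    (hdm : Measurable (Function.uncurry d)) (hd : ∀ x y, ‖x - y‖ ≤ d x y)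
    -- the network and the Lipschitz constant
    {Θ : Type*} (F : Θ → EuclideanSpace ℝ (Fin n) → ℝ → EuclideanSpace ℝ (Fin n))
    (L : ℝ) (hL : 0 < L) :
    ∃ (C : ℝ) (R : ℝ → ℝ), 0 ≤ C ∧ R =o[𝓝[>] (0 : ℝ)] (fun δ => δ) ∧
      ∀ θ : Θ,
        (∀ t ∈ Set.Icc ε T, ∀ x y,
          ‖ConsistencyModel.model F ε x t θ - ConsistencyModel.model F ε y t θ‖ ≤ L * ‖x - y‖) →
        ∀ q : ℝ → Measure (EuclideanSpace ℝ (Fin n)), (∀ t, IsProbabilityMeasure (q t)) →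
        ∀ G : ConsistencyModel.TimeGrid ε T, ∀ k ≤ G.N,
          let f := ConsistencyModel.model F ε
          let t := G.time k
          let fLaw := ConsistencyModel.generated f θ (q t) t
          let gLaw := ConsistencyModel.consistencyLaw p0 g t
          let bound := ENNReal.ofReal L *
              ConsistencyModel.wasserstein (q t) (ConsistencyModel.smoothed p0 t) +
            ConsistencyModel.ctLoss p0 d f θ θ G k +
            ENNReal.ofReal (t * (C * G.mesh) + R G.mesh)
          ConsistencyModel.wasserstein fLaw gLaw =
              ConsistencyModel.wasserstein fLaw (ConsistencyModel.smoothed p0 ε) ∧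
            ConsistencyModel.wasserstein fLaw gLaw ≤ bound ∧
            ConsistencyModel.wasserstein fLaw p0 ≤ bound + ENNReal.ofReal (ε * √n) := by
  -- the coupling argument needs no discretisation error, so both error terms may be taken zero
  refine ⟨0, 0, le_rfl, Asymptotics.isLittleO_zero _ _, fun θ hLip q hq G k hk => ?_⟩
  intro f t fLaw gLaw bound
  have hprob := hq t
  have ht : t ∈ Set.Icc ε T := G.mem_Icc hk
  have hgLaw : gLaw = ConsistencyModel.smoothed p0 ε :=
    ConsistencyModel.consistencyLaw_eq p0 hε hT hg ht
  have hfm : ∀ s ∈ Set.Icc ε T, Measurable fun x => f x s θ := fun s hs =>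
    (LipschitzWith.of_dist_le_mul (K := L.toNNReal) fun x y => by
      rw [Real.coe_toNNReal _ hL.le, dist_eq_norm, dist_eq_norm]
      exact hLip s hs x y).continuous.measurable
  have hp (s : ℝ) : IsProbabilityMeasure (ConsistencyModel.smoothed p0 s) := by
    rw [ConsistencyModel.smoothed_eq_noised]
    infer_instance
  have hfLaw : IsProbabilityMeasure fLaw :=
    Measure.isProbabilityMeasure_map (hfm t ht).aemeasurable
  have hmid : IsProbabilityMeasure
      (ConsistencyModel.generated f θ (ConsistencyModel.smoothed p0 t) t) :=
    Measure.isProbabilityMeasure_map (hfm t ht).aemeasurable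
  have hbound : ConsistencyModel.wasserstein fLaw (ConsistencyModel.smoothed p0 ε) ≤ bound :=
    calc _ ≤ _ := ConsistencyModel.wasserstein_triangle fLaw
          (ConsistencyModel.generated f θ (ConsistencyModel.smoothed p0 t) t) _
      _ ≤ ENNReal.ofReal L * ConsistencyModel.wasserstein (q t) (ConsistencyModel.smoothed p0 t) +
          ConsistencyModel.ctLoss p0 d f θ θ G k :=
        add_le_add (ConsistencyModel.wasserstein_map_le_of_lipschitz hL (hLip t ht) _ _)
          (ConsistencyModel.wasserstein_generated_le_ctLoss p0 hdm hd hfm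
            (fun x => ConsistencyModel.model_initial F ε x θ) G hk)
      _ ≤ bound := le_self_add
  rw [hgLaw]
  refine ⟨rfl, hbound, ?_⟩
  exact (ConsistencyModel.wasserstein_triangle fLaw (ConsistencyModel.smoothed p0 ε) p0).trans
    (add_le_add hbound (ConsistencyModel.wasserstein_smoothed_le p0 hε))
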